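/- Let $k$ be a commutative ring and let $H$ be a quasi-Hopf algebra over $k$: a unital associative $k$-algebra with algebra maps $\Delta:H\to H\otimes H$, $\epsilon:H\to k$ and an invertible $\phi=\phi^{(1)}\otimes\phi^{(2)}\otimes\phi^{(3)}\in H\otimes H\otimes H$, with inverse $\phi^{-1}=\phi^{(-1)}\otimes\phi^{(-2)}\otimes\phi^{(-3)}$ (sums understood), such that $(\epsilon\otimes \mathrm{id})\Delta=\mathrm{id}=(\mathrm{id}\otimes\epsilon)\Delta$, $(\mathrm{id}\otimes\Delta)\Delta(h)\cdot\phi=\phi\cdot(\Delta\otimes \mathrm{id})\Delta(h)$, $(\mathrm{id}\otimes \mathrm{id}\otimes\Delta)(\phi)\cdot(\Delta\otimes \mathrm{id}\otimes \mathrm{id})(\phi)=(1\otimes\phi)\cdot(\mathrm{id}\otimes\Delta\otimes \mathrm{id})(\phi)\cdot(\phi\otimes1)$ and $(\mathrm{id}\otimes\epsilon\otimes \mathrm{id})(\phi)=1\otimes 1$, together with an algebra anti-automorphism $S$ of $H$ and elements $\alpha,\beta\in H$ such that $S(h_{(1)})\,\alpha\, h_{(2)}=\epsilon(h)\alpha$,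 $h_{(1)}\,\beta\, S(h_{(2)})=\epsilon(h)\beta$, $\phi^{(1)}\beta S(\phi^{(2)})\alpha\phi^{(3)}=1$ and $S(\phi^{(-1)})\alpha\phi^{(-2)}\beta S(\phi^{(-3)})=1$. The category of left $H$-modules is monoidal, with $V\otimes W$ the tensor product over $k$ carrying the action through $\Delta$, unit object $k$ with action through $\epsilon$, and associator $\Phi\big((v\otimes w)\otimes x\big)=(\phi^{(1)}\triangleright v)\otimes\big((\phi^{(2)}\triangleright w)\otimes(\phi^{(3)}\triangleright x)\big)$. Let $A$ be an algebra (monoid object) in it. The category of $A$-bimodules in $H$-modules is monoidal with unit $A$ and with $V\otimes_A W$ the coequalizer of $r_V\otimes \mathrm{id}$ and $(\mathrm{id}\otimes l_W)\circ\Phi$ from $(V\otimes A)\otimes W$ to $V\otimes W$, where $l$, $r$ denote the left and right $A$-actions. The class of $v\otimes w$ is written $v\otimes_A w$. For $H$-modules $V,W$ let $\mathrm{hom}(V,W)$ be the $k$-module of all $k$-linear maps $L:V\to W$, with the adjoint action $h\triangleright L=(h_{(1)}\triangleright\,\cdot\,)\circ L\circ(S(h_{(2)})\triangleright\,\cdot\,)$.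 For an $H$-equivariant $f:V\otimes W\to X$ put $$\zeta(f)(v)(w)=f\big((\phi^{(-1)}\triangleright v)\otimes((\phi^{(-2)}\,\beta\, S(\phi^{(-3)}))\triangleright w)\big),$$ an $H$-equivariant map $\zeta(f):V\to\mathrm{hom}(W,X)$, and let $\mathrm{ev}:\mathrm{hom}(V,W)\otimes V\to W$ be the equivariant map $\mathrm{ev}(L\otimes v)=\phi^{(1)}\triangleright L\big((S(\phi^{(2)})\,\alpha\,\phi^{(3)})\triangleright v\big)$. With the composition $\bullet=\zeta(\mathrm{ev}\circ(\mathrm{id}\otimes \mathrm{ev})\circ\Phi)$, for $A$-bimodules $V,W$ the module $\mathrm{hom}(V,W)$ is an $A$-bimodule, with left action $\bullet\circ(\zeta(l_W)\otimes \mathrm{id})$ and right action $\bullet\circ(\mathrm{id}\otimes\zeta(l_V))$. Let $\mathrm{hom}_A(V,W)\subseteq\mathrm{hom}(V,W)$ be the equalizer of the two maps $$\zeta\big(\mathrm{ev}\circ(\mathrm{id}\otimes r_V)\big),\ \ \zeta\big(r_W\circ(\mathrm{ev}\otimes \mathrm{id}_A)\circ\Phi^{-1}\big):\ \mathrm{hom}(V,W)\longrightarrow\mathrm{hom}(V\otimes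 A,W),$$ that is, the kernel of their difference, with the restricted $H$-action and $A$-bimodule structure. It is functorial in $(V,W)$, contravariantly in $V$ and covariantly in $W$, through $L\mapsto g\circ L\circ f$. **Theorem.** The monoidal category of $A$-bimodules in $H$-modules is closed with internal hom functor $\mathrm{hom}_A$: there are bijections, natural in the $A$-bimodules $V,W,X$, $$\zeta^A:\mathrm{Hom}(V\otimes_A W,X)\longrightarrow\mathrm{Hom}(V,\mathrm{hom}_A(W,X))$$ between sets of morphisms of $A$-bimodules in $H$-modules, given by $$\zeta^A(f)(v)(w)=f\big((\phi^{(-1)}\triangleright v)\otimes_A((\phi^{(-2)}\,\beta\, S(\phi^{(-3)}))\triangleright w)\big),$$ $$(\zeta^A)^{-1}(g)(v\otimes_A w)=\phi^{(1)}\triangleright\Big(g(v)\big((S(\phi^{(2)})\,\alpha\,\phi^{(3)})\triangleright w\big)\Big).$$ Moreover $\mathrm{hom}_A$ is cut out by a weak right $A$-linearity condition: for $A$-bimodules $V,W$, an $H$-equivariant map $q:Z\to\mathrm{hom}(V,W)$ from an $H$-module $Z$ takes values in $\mathrm{hom}_A(V,W)$ if and only if, for all $z\in Z$, $v\in V$,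 $a\in A$, $$\mathrm{ev}\big(q(z)\otimes (v\,a)\big)=\mathrm{ev}\big((\phi^{(-1)}\triangleright q(z))\otimes(\phi^{(-2)}\triangleright v)\big)\,(\phi^{(-3)}\triangleright a).$$ -/

import Mathlib

open CategoryTheory MonoidalCategory TensorProduct Opposite

universe u

/-- A quasi-Hopf algebra `H` over the commutative ring `k`. The associator `φ` is an invertible
element of `H ⊗ (H ⊗ H)`, and all iterated tensor products are bracketed to the right. -/
class QuasiHopfAlgebra (k H : Type u) [CommRing k] [Ring H] [Algebra k H] where
  /-- coproduct -/
  Δ : H →ₐ[k] H ⊗[k] H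
  /-- counit -/
  ε : H →ₐ[k] k
  /-- associator -/
  φ : (H ⊗[k] (H ⊗[k] H))ˣ
  counit_left (h : H) :
    Algebra.TensorProduct.lid k H (Algebra.TensorProduct.map ε (AlgHom.id k H) (Δ h)) = h
  counit_right (h : H) :
    Algebra.TensorProduct.rid k k H (Algebra.TensorProduct.map (AlgHom.id k H) ε (Δ h)) = h
  quasi_coassoc (h : H) :
    Algebra.TensorProduct.map (AlgHom.id k H) Δ (Δ h) * φ.val =
      φ.val * Algebra.TensorProduct.assoc k k k H H H
        (Algebra.TensorProduct.map Δ (AlgHom.id k H) (Δ h))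
  pentagon :
    Algebra.TensorProduct.map (AlgHom.id k H) (Algebra.TensorProduct.map (AlgHom.id k H) Δ) φ.val *
        Algebra.TensorProduct.assoc k k k H H (H ⊗[k] H)
          (Algebra.TensorProduct.map Δ (AlgHom.id k (H ⊗[k] H)) φ.val) =
      ((1 : H) ⊗ₜ[k] φ.val) *
        Algebra.TensorProduct.map (AlgHom.id k H)
          ((Algebra.TensorProduct.assoc k k k H H H).toAlgHom.comp
            (Algebra.TensorProduct.map Δ (AlgHom.id k H))) φ.val *
        Algebra.TensorProduct.map (AlgHom.id k H) (Algebra.TensorProduct.assoc k k k H H H).toAlgHom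
          (Algebra.TensorProduct.assoc k k k H (H ⊗[k] H) H (φ.val ⊗ₜ[k] (1 : H)))
  counit_mid :
    Algebra.TensorProduct.map (AlgHom.id k H)
      ((Algebra.TensorProduct.lid k H).toAlgHom.comp
        (Algebra.TensorProduct.map ε (AlgHom.id k H))) φ.val = 1
  /-- quasi-antipode, an algebra anti-automorphism -/
  S : H ≃ₗ[k] H
  S_one : S 1 = 1
  S_mul (a b : H) : S (a * b) = S b * S a
  α : H
  β : H
  /-- `S(h₁) α h₂ = ε(h) α` -/
  antipode_left (h : H) :
    LinearMap.mul' k H (TensorProduct.map (LinearMap.mulRight k α ∘ₗ S.toLinearMap)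
      LinearMap.id (Δ h)) = ε h • α
  /-- `h₁ β S(h₂) = ε(h) β` -/
  antipode_right (h : H) :
    LinearMap.mul' k H (TensorProduct.map (LinearMap.mulRight k β) S.toLinearMap (Δ h)) = ε h • β
  /-- `φ¹ β S(φ²) α φ³ = 1` -/
  antipode_φ :
    LinearMap.mul' k H (TensorProduct.map (LinearMap.mulRight k β)
      (LinearMap.mul' k H ∘ₗ TensorProduct.map (LinearMap.mulRight k α ∘ₗ S.toLinearMap)
        LinearMap.id) φ.val) = 1
  /-- `S(φ⁻¹) α φ⁻² β S(φ⁻³) = 1`, with the legs of the inverse of `φ` -/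
  antipode_φ_inv :
    LinearMap.mul' k H (TensorProduct.map (LinearMap.mulRight k α ∘ₗ S.toLinearMap)
      (LinearMap.mul' k H ∘ₗ TensorProduct.map (LinearMap.mulRight k β) S.toLinearMap)
      φ⁻¹.val) = 1

/-- A left `H`-module: a `k`-module with a `k`-linear action of the `k`-algebra `H`. -/
structure HRep (k H : Type u) [CommRing k] [Ring H] [Algebra k H] where
  carrier : Type u
  [addCommGroup : AddCommGroup carrier]
  [module : Module k carrier]
  /-- the `H`-action -/
  ρ : H →ₐ[k] Module.End k carrier

namespace HRep

instance {k H : Type u} [CommRing k] [Ring H] [Algebra k H] : CoeSort (HRep k H) (Type u) :=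
  ⟨HRep.carrier⟩

attribute [instance] HRep.addCommGroup HRep.module

section Cat

variable {k H : Type u} [CommRing k] [Ring H] [Algebra k H]

/-- An `H`-equivariant `k`-linear map. -/
@[ext]
structure Hom (V W : HRep k H) where
  toLin : V →ₗ[k] W
  comm (h : H) (v : V) : toLin (V.ρ h v) = W.ρ h (toLin v)

instance : Category (HRep k H) where
  Hom := Hom
  id V := ⟨LinearMap.id, fun _ _ => rfl⟩
  comp f g := ⟨g.toLin ∘ₗ f.toLin, fun h v => by simp [f.comm, g.comm]⟩

theorem hom_ext {V W : HRep k H} {f g : V ⟶ W} (h : ∀ v, f.toLin v = g.toLin v) : f = g :=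
  Hom.ext (LinearMap.ext h)

theorem hom_ext_lin {V W : HRep k H} {f g : V ⟶ W} (h : f.toLin = g.toLin) : f = g :=
  Hom.ext h

@[simp] theorem id_toLin (V : HRep k H) : Hom.toLin (𝟙 V) = LinearMap.id := rfl

@[simp] theorem comp_toLin {U V W : HRep k H} (f : U ⟶ V) (g : V ⟶ W) :
    Hom.toLin (f ≫ g) = g.toLin ∘ₗ f.toLin := rfl

/-- An invertible equivariant map is an isomorphism. -/
def isoOfLin {V W : HRep k H} (e : V ≃ₗ[k] W) (h : ∀ (a : H) (v : V), e (V.ρ a v) = W.ρ a (e v)) :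
    V ≅ W where
  hom := ⟨e.toLinearMap, h⟩
  inv := ⟨e.symm.toLinearMap, fun a w => by
    have := h a (e.symm w)
    simp only [LinearEquiv.apply_symm_apply] at this
    simp [← this]⟩
  hom_inv_id := hom_ext fun v => e.symm_apply_apply v
  inv_hom_id := hom_ext fun v => e.apply_symm_apply v

end Cat

section Act

variable {k A B C D V W X : Type u} [CommRing k] [Ring A] [Algebra k A] [Ring B] [Algebra k B]
  [Ring C] [Algebra k C] [Ring D] [Algebra k D]
  [AddCommGroup V] [Module k V] [AddCommGroup W] [Module k W] [AddCommGroup X] [Module k X]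

/-- The action of `A ⊗ B` on `V ⊗ W`. -/
noncomputable def actT (f : A →ₐ[k] Module.End k V) (g : B →ₐ[k] Module.End k W) :
    A ⊗[k] B →ₐ[k] Module.End k (V ⊗[k] W) :=
  Module.endTensorEndAlgHom.comp (Algebra.TensorProduct.map f g)

@[simp] theorem actT_tmul (f : A →ₐ[k] Module.End k V) (g : B →ₐ[k] Module.End k W)
    (a : A) (b : B) (v : V) (w : W) : actT f g (a ⊗ₜ b) (v ⊗ₜ w) = f a v ⊗ₜ[k] g b w := rfl

theorem actT_comp (f : A →ₐ[k] Module.End k V) (g : B →ₐ[k] Module.End k W)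
    (a : C →ₐ[k] A) (b : D →ₐ[k] B) (t : C ⊗[k] D) :
    actT (f.comp a) (g.comp b) t = actT f g (Algebra.TensorProduct.map a b t) := by
  induction t with
  | zero => simp
  | add x y hx hy => simp [hx, hy]
  | tmul c d => rfl

theorem actT_assoc (f : A →ₐ[k] Module.End k V) (g : B →ₐ[k] Module.End k W)
    (e : C →ₐ[k] Module.End k X) (t : (A ⊗[k] B) ⊗[k] C) (x : (V ⊗[k] W) ⊗[k] X) :
    TensorProduct.assoc k V W X (actT (actT f g) e t x) =
      actT f (actT g e) (Algebra.TensorProduct.assoc k k k A B C t)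
        (TensorProduct.assoc k V W X x) := by
  induction t with
  | zero => simp
  | add x y hx hy => simp [hx, hy]
  | tmul t c =>
    induction t with
    | zero => simp
    | add x y hx hy => simp only [TensorProduct.add_tmul, map_add, LinearMap.add_apply, hx, hy]
    | tmul a b =>
      induction x with
      | zero => simp
      | add x y hx hy => simp only [map_add, hx, hy]
      | tmul x z =>
        induction x with
        | zero => simp
        | add x y hx hy => simp only [TensorProduct.add_tmul, map_add, hx, hy]
        | tmul x y => rfl

theorem actT_nat {V' W' : Type u} [AddCommGroup V'] [Module k V'] [AddCommGroup W'] [Module k W']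
    {f : A →ₐ[k] Module.End k V} {g : B →ₐ[k] Module.End k W}
    {f' : C →ₐ[k] Module.End k V'} {g' : D →ₐ[k] Module.End k W'}
    (p : V →ₗ[k] V') (q : W →ₗ[k] W') (i : A →ₐ[k] C) (j : B →ₐ[k] D)
    (hp : ∀ a v, p (f a v) = f' (i a) (p v))
    (hq : ∀ a v, q (g a v) = g' (j a) (q v)) (t : A ⊗[k] B) (x : V ⊗[k] W) :
    TensorProduct.map p q (actT f g t x) =
      actT f' g' (Algebra.TensorProduct.map i j t) (TensorProduct.map p q x) := by
  induction t with
  | zero => simp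
  | add x y hx hy => simp [hx, hy]
  | tmul a b =>
    induction x with
    | zero => simp
    | add x y hx hy => simp only [map_add, hx, hy]
    | tmul x y => simp [hp, hq]

end Act

section Monoidal

open QuasiHopfAlgebra

variable {k H : Type u} [CommRing k] [Ring H] [Algebra k H] [QuasiHopfAlgebra k H]

/-- `V ⊗ W`, with `H` acting through the coproduct. -/
noncomputable def tensor (V W : HRep k H) : HRep k H where
  carrier := V ⊗[k] W
  ρ := (actT V.ρ W.ρ).comp Δ

variable (k H) in
/-- The unit object: `k`, with `H` acting through the counit. -/
noncomputable def unit : HRep k H where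
  carrier := k
  ρ := (Algebra.lmul k k).comp ε

/-- The tensor product of morphisms. -/
noncomputable def tensorMap {V W X Y : HRep k H} (f : V ⟶ X) (g : W ⟶ Y) :
    tensor V W ⟶ tensor X Y :=
  ⟨TensorProduct.map f.toLin g.toLin, fun h x => by
    have := actT_nat f.toLin g.toLin (AlgHom.id k H) (AlgHom.id k H) f.comm g.comm
      (Δ (k := k) h) x
    rw [Algebra.TensorProduct.map_id] at this
    exact this⟩

/-- The action of `H ⊗ (H ⊗ H)` on a threefold tensor product. -/
noncomputable abbrev act3 (V W X : HRep k H) :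
    H ⊗[k] (H ⊗[k] H) →ₐ[k] Module.End k (V ⊗[k] (W ⊗[k] X)) :=
  actT V.ρ (actT W.ρ X.ρ)

/-- The action of an invertible element, as a linear automorphism. -/
noncomputable def unitAct {A V : Type u} [Ring A] [Algebra k A] [AddCommGroup V] [Module k V]
    (f : A →ₐ[k] Module.End k V) (a : Aˣ) : V ≃ₗ[k] V :=
  LinearEquiv.ofLinearMap (f a.val) (f a⁻¹.val)
    (by rw [← Module.End.mul_eq_comp, ← map_mul]; simp [Module.End.one_eq_id])
    (by rw [← Module.End.mul_eq_comp, ← map_mul]; simp [Module.End.one_eq_id])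

theorem assoc_comm (V W X : HRep k H) (h : H) (x : (V ⊗[k] W) ⊗[k] X) :
    act3 V W X φ.val (TensorProduct.assoc k V W X
      (actT ((actT V.ρ W.ρ).comp Δ) X.ρ (Δ h) x)) =
      actT V.ρ ((actT W.ρ X.ρ).comp Δ) (Δ h)
        (act3 V W X φ.val (TensorProduct.assoc k V W X x)) := by
  have h1 := actT_comp (actT V.ρ W.ρ) X.ρ (Δ (k := k)) (AlgHom.id k H) (Δ h)
  have h2 := actT_comp V.ρ (actT W.ρ X.ρ) (AlgHom.id k H) (Δ (k := k)) (Δ h)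
  rw [AlgHom.comp_id] at h1 h2
  rw [h1, h2, actT_assoc, ← Module.End.mul_apply, ← Module.End.mul_apply, ← map_mul, ← map_mul,
    quasi_coassoc]

/-- The associator: rebracket, then act with `φ`. -/
noncomputable def assoc (V W X : HRep k H) : tensor (tensor V W) X ≅ tensor V (tensor W X) :=
  isoOfLin ((TensorProduct.assoc k V W X).trans (unitAct (act3 V W X) φ)) (assoc_comm V W X)

theorem lid_comm (V : HRep k H) (h : H) (x : k ⊗[k] V) :
    TensorProduct.lid k V (actT ((Algebra.lmul k k).comp ε) V.ρ (Δ h) x) =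
      V.ρ h (TensorProduct.lid k V x) := by
  suffices ∀ t : H ⊗[k] H, TensorProduct.lid k V (actT ((Algebra.lmul k k).comp ε) V.ρ t x) =
      V.ρ (Algebra.TensorProduct.lid k H (Algebra.TensorProduct.map ε (AlgHom.id k H) t))
        (TensorProduct.lid k V x) by
    rw [this, counit_left]
  intro t
  induction t with
  | zero => simp
  | add x y hx hy => simp only [map_add, LinearMap.add_apply, hx, hy]
  | tmul a b =>
    induction x with
    | zero => simp
    | add x y hx hy => simp only [map_add, hx, hy]
    | tmul c v => simp [smul_smul, mul_comm]

theorem rid_comm (V : HRep k H) (h : H) (x : V ⊗[k] k) :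
    TensorProduct.rid k V (actT V.ρ ((Algebra.lmul k k).comp ε) (Δ h) x) =
      V.ρ h (TensorProduct.rid k V x) := by
  suffices ∀ t : H ⊗[k] H, TensorProduct.rid k V (actT V.ρ ((Algebra.lmul k k).comp ε) t x) =
      V.ρ (Algebra.TensorProduct.rid k k H (Algebra.TensorProduct.map (AlgHom.id k H) ε t))
        (TensorProduct.rid k V x) by
    rw [this, counit_right]
  intro t
  induction t with
  | zero => simp
  | add x y hx hy => simp only [map_add, LinearMap.add_apply, hx, hy]
  | tmul a b =>
    induction x with
    | zero => simp
    | add x y hx hy => simp only [map_add, hx, hy]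
    | tmul c v => simp [smul_smul, mul_comm]

/-- The left unitor. -/
noncomputable def leftUnitor (V : HRep k H) : tensor (unit k H) V ≅ V :=
  isoOfLin (TensorProduct.lid k V) (lid_comm V)

/-- The right unitor. -/
noncomputable def rightUnitor (V : HRep k H) : tensor V (unit k H) ≅ V :=
  isoOfLin (TensorProduct.rid k V) (rid_comm V)

noncomputable instance : MonoidalCategoryStruct (HRep k H) where
  tensorObj := tensor
  whiskerLeft V _ _ f := tensorMap (𝟙 V) f
  whiskerRight f V := tensorMap f (𝟙 V)
  tensorHom f g := tensorMap f g
  tensorUnit := unit k H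
  associator := assoc
  leftUnitor := leftUnitor
  rightUnitor := rightUnitor

theorem tensor_ext {V W X : HRep k H} {f g : V ⊗ W ⟶ X}
    (h : ∀ (v : V) (w : W), f.toLin (v ⊗ₜ[k] w) = g.toLin (v ⊗ₜ[k] w)) : f = g :=
  Hom.ext (TensorProduct.ext' h)

theorem pentagon_right (W X Y Z : HRep k H) (x : ((W ⊗[k] X) ⊗[k] Y) ⊗[k] Z) :
    actT W.ρ (actT X.ρ ((actT Y.ρ Z.ρ).comp Δ)) φ.val (TensorProduct.assoc k W X (Y ⊗[k] Z)
      (actT ((actT W.ρ X.ρ).comp Δ) (actT Y.ρ Z.ρ) φ.val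
        (TensorProduct.assoc k (W ⊗[k] X) Y Z x))) =
      actT W.ρ (actT X.ρ (actT Y.ρ Z.ρ)) (Algebra.TensorProduct.map (AlgHom.id k H)
        (Algebra.TensorProduct.map (AlgHom.id k H) Δ) φ.val *
        Algebra.TensorProduct.assoc k k k H H (H ⊗[k] H)
          (Algebra.TensorProduct.map Δ (AlgHom.id k (H ⊗[k] H)) φ.val))
        (TensorProduct.assoc k W X (Y ⊗[k] Z) (TensorProduct.assoc k (W ⊗[k] X) Y Z x)) := by
  have h1 := actT_comp (actT W.ρ X.ρ) (actT Y.ρ Z.ρ) (Δ (k := k) (H := H)) (AlgHom.id k _) φ.val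
  have h3 : actT X.ρ ((actT Y.ρ Z.ρ).comp Δ) = (actT X.ρ (actT Y.ρ Z.ρ)).comp
      (Algebra.TensorProduct.map (AlgHom.id k H) Δ) :=
    AlgHom.ext fun t => actT_comp X.ρ (actT Y.ρ Z.ρ) (AlgHom.id k _) (Δ (k := k)) t
  have h2 := actT_comp W.ρ (actT X.ρ (actT Y.ρ Z.ρ)) (AlgHom.id k H)
    (Algebra.TensorProduct.map (AlgHom.id k H) (Δ (k := k) (H := H))) φ.val
  rw [AlgHom.comp_id] at h1 h2
  rw [h1, h3, h2, actT_assoc, map_mul]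
  rfl

theorem pentagon_left (W X Y Z : HRep k H) (x : ((W ⊗[k] X) ⊗[k] Y) ⊗[k] Z) :
    TensorProduct.map LinearMap.id (act3 X Y Z φ.val ∘ₗ (TensorProduct.assoc k X Y Z).toLinearMap)
      (actT W.ρ (actT ((actT X.ρ Y.ρ).comp Δ) Z.ρ) φ.val (TensorProduct.assoc k W (X ⊗[k] Y) Z
        (TensorProduct.map (act3 W X Y φ.val ∘ₗ (TensorProduct.assoc k W X Y).toLinearMap)
          LinearMap.id x))) =
      actT W.ρ (actT X.ρ (actT Y.ρ Z.ρ)) (((1 : H) ⊗ₜ[k] φ.val) *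
        Algebra.TensorProduct.map (AlgHom.id k H)
          ((Algebra.TensorProduct.assoc k k k H H H).toAlgHom.comp
            (Algebra.TensorProduct.map Δ (AlgHom.id k H))) φ.val *
        Algebra.TensorProduct.map (AlgHom.id k H) (Algebra.TensorProduct.assoc k k k H H H).toAlgHom
          (Algebra.TensorProduct.assoc k k k H (H ⊗[k] H) H (φ.val ⊗ₜ[k] (1 : H))))
        (TensorProduct.assoc k W X (Y ⊗[k] Z) (TensorProduct.assoc k (W ⊗[k] X) Y Z x)) := by
  have hA (y : W ⊗[k] ((X ⊗[k] Y) ⊗[k] Z)) :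
      TensorProduct.map LinearMap.id
        (act3 X Y Z φ.val ∘ₗ (TensorProduct.assoc k X Y Z).toLinearMap) y =
      actT W.ρ (act3 X Y Z) ((1 : H) ⊗ₜ[k] φ.val)
        (TensorProduct.map LinearMap.id (TensorProduct.assoc k X Y Z).toLinearMap y) := by
    induction y with
    | zero => simp
    | add x y hx hy => simp only [map_add, hx, hy]
    | tmul a b => simp
  have hC (y : ((W ⊗[k] X) ⊗[k] Y) ⊗[k] Z) :
      TensorProduct.map (act3 W X Y φ.val ∘ₗ (TensorProduct.assoc k W X Y).toLinearMap)
        LinearMap.id y =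
      actT (act3 W X Y) Z.ρ (φ.val ⊗ₜ[k] (1 : H))
        (TensorProduct.map (TensorProduct.assoc k W X Y).toLinearMap LinearMap.id y) := by
    induction y with
    | zero => simp
    | add x y hx hy => simp only [map_add, hx, hy]
    | tmul a b => simp
  have hB (s : H ⊗[k] ((H ⊗[k] H) ⊗[k] H)) (y : W ⊗[k] ((X ⊗[k] Y) ⊗[k] Z)) :=
    actT_nat (f := W.ρ) (f' := W.ρ) (g := actT (actT X.ρ Y.ρ) Z.ρ) (g' := act3 X Y Z)
      LinearMap.id (TensorProduct.assoc k X Y Z).toLinearMap (AlgHom.id k H)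
      (Algebra.TensorProduct.assoc k k k H H H).toAlgHom (fun _ _ => rfl)
      (fun a v => actT_assoc _ _ _ a v) s y
  have h3 : actT ((actT X.ρ Y.ρ).comp (Δ (k := k) (H := H))) Z.ρ = (actT (actT X.ρ Y.ρ) Z.ρ).comp
      (Algebra.TensorProduct.map Δ (AlgHom.id k H)) :=
    AlgHom.ext fun t => actT_comp (actT X.ρ Y.ρ) Z.ρ (Δ (k := k)) (AlgHom.id k _) t
  have h2 := actT_comp W.ρ (actT (actT X.ρ Y.ρ) Z.ρ) (AlgHom.id k H)
    (Algebra.TensorProduct.map (Δ (k := k) (H := H)) (AlgHom.id k H)) φ.val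
  have hD : TensorProduct.map LinearMap.id (TensorProduct.assoc k X Y Z).toLinearMap
      (TensorProduct.assoc k W (X ⊗[k] Y) Z
        (TensorProduct.map (TensorProduct.assoc k W X Y).toLinearMap LinearMap.id x)) =
      TensorProduct.assoc k W X (Y ⊗[k] Z) (TensorProduct.assoc k (W ⊗[k] X) Y Z x) := by
    have : (TensorProduct.map LinearMap.id (TensorProduct.assoc k X Y Z).toLinearMap ∘ₗ
      (TensorProduct.assoc k W (X ⊗[k] Y) Z).toLinearMap) ∘ₗ
        TensorProduct.map (TensorProduct.assoc k W X Y).toLinearMap LinearMap.id =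
      (TensorProduct.assoc k W X (Y ⊗[k] Z)).toLinearMap ∘ₗ
        (TensorProduct.assoc k (W ⊗[k] X) Y Z).toLinearMap := by
      ext
      rfl
    exact LinearMap.congr_fun this x
  have h4 : Algebra.TensorProduct.map (AlgHom.id k H)
      (Algebra.TensorProduct.assoc k k k H H H).toAlgHom (Algebra.TensorProduct.map (AlgHom.id k H)
        (Algebra.TensorProduct.map (Δ (k := k)) (AlgHom.id k H)) φ.val) =
      Algebra.TensorProduct.map (AlgHom.id k H)
          ((Algebra.TensorProduct.assoc k k k H H H).toAlgHom.comp
            (Algebra.TensorProduct.map Δ (AlgHom.id k H))) φ.val := by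
    rw [← AlgHom.comp_apply, ← Algebra.TensorProduct.map_comp, AlgHom.comp_id]
  rw [AlgHom.comp_id] at h2
  rw [hA, h3, h2, hB, hC, actT_assoc, hB, hD, h4, map_mul, map_mul]
  rfl

theorem triangle_aux (V W : HRep k H) (x : (V ⊗[k] k) ⊗[k] W) :
    TensorProduct.map LinearMap.id (TensorProduct.lid k W).toLinearMap
      (actT V.ρ (actT ((Algebra.lmul k k).comp ε) W.ρ) φ.val (TensorProduct.assoc k V k W x)) =
    TensorProduct.map (TensorProduct.rid k V).toLinearMap LinearMap.id x := by
  have h1 := actT_nat (f := V.ρ) (f' := V.ρ)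
    (g := actT ((Algebra.lmul k k).comp (ε (k := k) (H := H))) W.ρ) (g' := W.ρ)
    LinearMap.id (TensorProduct.lid k W).toLinearMap (AlgHom.id k H)
    ((Algebra.TensorProduct.lid k H).toAlgHom.comp
        (Algebra.TensorProduct.map ε (AlgHom.id k H))) (fun _ _ => rfl) (fun t y => by
      induction t with
      | zero => simp
      | add x y hx hy => simp only [map_add, LinearMap.add_apply, hx, hy]
      | tmul a b =>
        induction y with
        | zero => simp
        | add x y hx hy => simp only [map_add, hx, hy]
        | tmul c v => simp [smul_smul, mul_comm]) φ.val (TensorProduct.assoc k V k W x)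
  rw [h1, counit_mid, map_one, Module.End.one_apply]
  have : TensorProduct.map LinearMap.id (TensorProduct.lid k W).toLinearMap ∘ₗ
      (TensorProduct.assoc k V k W).toLinearMap =
    TensorProduct.map (TensorProduct.rid k V).toLinearMap LinearMap.id := by
    ext
    simp
  exact LinearMap.congr_fun this x

theorem assoc_nat {V W X V' W' X' : HRep k H} (f : V ⟶ V') (g : W ⟶ W') (h : X ⟶ X')
    (x : (V ⊗[k] W) ⊗[k] X) :
    act3 V' W' X' φ.val (TensorProduct.assoc k V' W' X'
      (TensorProduct.map (TensorProduct.map f.toLin g.toLin) h.toLin x)) =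
    TensorProduct.map f.toLin (TensorProduct.map g.toLin h.toLin)
      (act3 V W X φ.val (TensorProduct.assoc k V W X x)) := by
  have h1 := actT_nat f.toLin (TensorProduct.map g.toLin h.toLin) (AlgHom.id k H)
    (AlgHom.id k (H ⊗[k] H)) f.comm (fun t y => by
      have := actT_nat g.toLin h.toLin (AlgHom.id k H) (AlgHom.id k H) g.comm h.comm t y
      rw [Algebra.TensorProduct.map_id] at this
      exact this) (φ (k := k) (H := H)).val (TensorProduct.assoc k V W X x)
  rw [Algebra.TensorProduct.map_id] at h1
  refine Eq.trans ?_ h1.symm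
  have : (TensorProduct.assoc k V' W' X').toLinearMap ∘ₗ
      TensorProduct.map (TensorProduct.map f.toLin g.toLin) h.toLin =
    TensorProduct.map f.toLin (TensorProduct.map g.toLin h.toLin) ∘ₗ
      (TensorProduct.assoc k V W X).toLinearMap := by
    ext
    rfl
  exact congrArg _ (LinearMap.congr_fun this x)

noncomputable instance : MonoidalCategory (HRep k H) where
  id_tensorHom_id V W := hom_ext_lin TensorProduct.map_id
  tensorHom_comp_tensorHom f g p q := hom_ext_lin (TensorProduct.map_comp _ _ _ _).symm
  tensorHom_def f g := tensor_ext fun _ _ => rfl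
  whiskerLeft_id V W := hom_ext_lin TensorProduct.map_id
  id_whiskerRight V W := hom_ext_lin TensorProduct.map_id
  associator_naturality {X₁ X₂ X₃ Y₁ Y₂ Y₃} f g h := hom_ext fun x =>
    assoc_nat f g h x
  leftUnitor_naturality f := tensor_ext fun c v => (f.toLin.map_smul c v).symm
  rightUnitor_naturality f := tensor_ext fun v c => (f.toLin.map_smul c v).symm
  pentagon W X Y Z := hom_ext fun x =>
    (pentagon_left W X Y Z x).trans <| by
      rw [← QuasiHopfAlgebra.pentagon]
      exact (pentagon_right W X Y Z x).symm
  triangle V W := hom_ext (triangle_aux V W)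

end Monoidal


section Closed

set_option maxSynthPendingDepth 8

open QuasiHopfAlgebra

theorem ind3 {k A B C : Type u} [CommRing k] [AddCommGroup A] [Module k A] [AddCommGroup B]
    [Module k B] [AddCommGroup C] [Module k C] {p : A ⊗[k] (B ⊗[k] C) → Prop} (zero : p 0)
    (add : ∀ x y, p x → p y → p (x + y)) (tmul : ∀ a b c, p (a ⊗ₜ (b ⊗ₜ c))) (t) : p t := by
  induction t with
  | zero => exact zero
  | add x y hx hy => exact add x y hx hy
  | tmul a s =>
    induction s with
    | zero => rw [TensorProduct.tmul_zero]; exact zero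
    | add x y hx hy => rw [TensorProduct.tmul_add]; exact add _ _ hx hy
    | tmul b c => exact tmul a b c

theorem ind4 {k A B C D : Type u} [CommRing k] [AddCommGroup A] [Module k A] [AddCommGroup B]
    [Module k B] [AddCommGroup C] [Module k C] [AddCommGroup D] [Module k D]
    {p : A ⊗[k] (B ⊗[k] (C ⊗[k] D)) → Prop} (zero : p 0)
    (add : ∀ x y, p x → p y → p (x + y)) (tmul : ∀ a b c d, p (a ⊗ₜ (b ⊗ₜ (c ⊗ₜ d)))) (t) :
    p t := by
  induction t with
  | zero => exact zero
  | add x y hx hy => exact add x y hx hy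
  | tmul a s =>
    induction s using ind3 with
    | zero => rw [TensorProduct.tmul_zero]; exact zero
    | add x y hx hy => rw [TensorProduct.tmul_add]; exact add _ _ hx hy
    | tmul b c d => exact tmul a b c d

variable {k H : Type u} [CommRing k] [Ring H] [Algebra k H] [QuasiHopfAlgebra k H]

variable (k H) in
/-- `a ⊗ b ↦ S(a) α b` -/
noncomputable def mα : H ⊗[k] H →ₗ[k] H :=
  LinearMap.mul' k H ∘ₗ TensorProduct.map
    (LinearMap.mulRight k (α (k := k)) ∘ₗ (S (k := k) (H := H)).toLinearMap) LinearMap.id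

variable (k H) in
/-- `a ⊗ b ↦ a β S(b)` -/
noncomputable def mβ : H ⊗[k] H →ₗ[k] H :=
  LinearMap.mul' k H ∘ₗ TensorProduct.map (LinearMap.mulRight k (β (k := k)))
    (S (k := k) (H := H)).toLinearMap

@[simp] theorem mα_tmul (a b : H) : mα k H (a ⊗ₜ b) = S (k := k) a * α k * b := rfl
@[simp] theorem mβ_tmul (a b : H) : mβ k H (a ⊗ₜ b) = a * β k * S (k := k) b := rfl

theorem mα_Δ (h : H) : mα k H (Δ h) = ε (k := k) h • α k := antipode_left h
theorem mβ_Δ (h : H) : mβ k H (Δ h) = ε (k := k) h • β k := antipode_right h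

variable (k H) in
/-- `a ⊗ (b ⊗ c) ↦ a β S(b) α c` -/
noncomputable def mβα : H ⊗[k] (H ⊗[k] H) →ₗ[k] H :=
  LinearMap.mul' k H ∘ₗ TensorProduct.map (LinearMap.mulRight k (β (k := k))) (mα k H)

variable (k H) in
/-- `a ⊗ (b ⊗ c) ↦ S(a) α b β S(c)` -/
noncomputable def mαβ : H ⊗[k] (H ⊗[k] H) →ₗ[k] H :=
  LinearMap.mul' k H ∘ₗ TensorProduct.map
    (LinearMap.mulRight k (α (k := k)) ∘ₗ (S (k := k) (H := H)).toLinearMap) (mβ k H)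

theorem mβα_tmul (a : H) (t : H ⊗[k] H) : mβα k H (a ⊗ₜ t) = a * β k * mα k H t := rfl
theorem mαβ_tmul (a : H) (t : H ⊗[k] H) :
    mαβ k H (a ⊗ₜ t) = S (k := k) a * α k * mβ k H t := rfl

variable (k H) in
/-- `(id ⊗ id ⊗ ε)` -/
noncomputable def ε3 : H ⊗[k] (H ⊗[k] H) →ₐ[k] H ⊗[k] H :=
  Algebra.TensorProduct.map (AlgHom.id k H) ((Algebra.TensorProduct.rid k k H).toAlgHom.comp
    (Algebra.TensorProduct.map (AlgHom.id k H) ε))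

variable (k H) in
/-- `(id ⊗ ε ⊗ id)` -/
noncomputable def ε2 : H ⊗[k] (H ⊗[k] H) →ₐ[k] H ⊗[k] H :=
  Algebra.TensorProduct.map (AlgHom.id k H) ((Algebra.TensorProduct.lid k H).toAlgHom.comp
    (Algebra.TensorProduct.map ε (AlgHom.id k H)))

@[simp] theorem ε3_tmul (a b c : H) : ε3 k H (a ⊗ₜ (b ⊗ₜ c)) = ε (k := k) c • (a ⊗ₜ b) := by
  simp [ε3]

@[simp] theorem ε2_tmul (a b c : H) : ε2 k H (a ⊗ₜ (b ⊗ₜ c)) = ε (k := k) b • (a ⊗ₜ c) := by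
  simp [ε2]

theorem ε2_φ : ε2 k H φ.val = 1 := counit_mid

variable (k H) in
/-- `(id ⊗ id ⊗ Δ)` -/
noncomputable def Δ3 : H ⊗[k] (H ⊗[k] H) →ₐ[k] H ⊗[k] (H ⊗[k] (H ⊗[k] H)) :=
  Algebra.TensorProduct.map (AlgHom.id k H) (Algebra.TensorProduct.map (AlgHom.id k H) Δ)

variable (k H) in
/-- `(id ⊗ Δ ⊗ id)` -/
noncomputable def Δ2 : H ⊗[k] (H ⊗[k] H) →ₐ[k] H ⊗[k] (H ⊗[k] (H ⊗[k] H)) :=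
  Algebra.TensorProduct.map (AlgHom.id k H) ((Algebra.TensorProduct.assoc k k k H H H).toAlgHom.comp
    (Algebra.TensorProduct.map Δ (AlgHom.id k H)))

variable (k H) in
/-- `(Δ ⊗ id ⊗ id)` -/
noncomputable def Δ1 : H ⊗[k] (H ⊗[k] H) →ₐ[k] H ⊗[k] (H ⊗[k] (H ⊗[k] H)) :=
  (Algebra.TensorProduct.assoc k k k H H (H ⊗[k] H)).toAlgHom.comp
    (Algebra.TensorProduct.map Δ (AlgHom.id k (H ⊗[k] H)))

variable (k H) in
/-- `t ↦ t ⊗ 1` -/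
noncomputable def pad : H ⊗[k] (H ⊗[k] H) →ₐ[k] H ⊗[k] (H ⊗[k] (H ⊗[k] H)) :=
  Algebra.TensorProduct.map (AlgHom.id k H)
    (Algebra.TensorProduct.map (AlgHom.id k H) Algebra.TensorProduct.includeLeft)

variable (k H) in
/-- `t ↦ 1 ⊗ t` -/
noncomputable def padl : H ⊗[k] (H ⊗[k] H) →ₐ[k] H ⊗[k] (H ⊗[k] (H ⊗[k] H)) :=
  Algebra.TensorProduct.includeRight

theorem pad_eq (t : H ⊗[k] (H ⊗[k] H)) : pad k H t =
    Algebra.TensorProduct.map (AlgHom.id k H) (Algebra.TensorProduct.assoc k k k H H H).toAlgHom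
          (Algebra.TensorProduct.assoc k k k H (H ⊗[k] H) H (t ⊗ₜ[k] (1 : H))) := by
  induction t using ind3 with
  | zero => simp
  | add x y hx hy => simp only [map_add, TensorProduct.add_tmul, hx, hy]
  | tmul a b c => rfl

theorem pent : Δ3 k H φ.val * Δ1 k H φ.val = padl k H φ.val * Δ2 k H φ.val * pad k H φ.val := by
  rw [pad_eq]
  exact QuasiHopfAlgebra.pentagon

/-- The two sides of the pentagon, solved for two of the factors. -/
theorem pent1 : Δ1 k H φ.val * pad k H φ⁻¹.val =
    Δ3 k H φ⁻¹.val * (padl k H φ.val * Δ2 k H φ.val) := by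
  have h1 : Δ3 k H φ⁻¹.val * Δ3 k H φ.val = 1 := by rw [← map_mul]; simp
  have h2 : pad k H φ.val * pad k H φ⁻¹.val = 1 := by rw [← map_mul]; simp
  calc _ = Δ3 k H φ⁻¹.val * (Δ3 k H φ.val * Δ1 k H φ.val) * pad k H φ⁻¹.val := by
        rw [← mul_assoc, h1, one_mul]
    _ = _ := by rw [pent]; simp only [mul_assoc, h2, mul_one]

theorem pent2 : pad k H φ.val * Δ1 k H φ⁻¹.val =
    Δ2 k H φ⁻¹.val * (padl k H φ⁻¹.val * Δ3 k H φ.val) := by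
  have h1 : Δ2 k H φ⁻¹.val * Δ2 k H φ.val = 1 := by rw [← map_mul]; simp
  have h3 : padl k H φ⁻¹.val * padl k H φ.val = 1 := by rw [← map_mul]; simp
  have h2 : Δ1 k H φ.val * Δ1 k H φ⁻¹.val = 1 := by rw [← map_mul]; simp
  calc _ = Δ2 k H φ⁻¹.val * (padl k H φ⁻¹.val *
        (padl k H φ.val * Δ2 k H φ.val * pad k H φ.val)) * Δ1 k H φ⁻¹.val := by
        simp only [← mul_assoc]
        rw [mul_assoc (Δ2 k H φ⁻¹.val), h3, mul_one, h1, one_mul]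
    _ = _ := by rw [← pent]; simp only [mul_assoc, h2, mul_one]

theorem ε3_φ : ε3 k H φ.val = 1 := by
  -- apply the counit to the third leg of the pentagon
  let E : H ⊗[k] (H ⊗[k] (H ⊗[k] H)) →ₐ[k] H ⊗[k] (H ⊗[k] H) :=
    Algebra.TensorProduct.map (AlgHom.id k H) (ε2 k H)
  have hE (a b c d : H) : E (a ⊗ₜ (b ⊗ₜ (c ⊗ₜ d))) = ε (k := k) c • (a ⊗ₜ (b ⊗ₜ d)) := by
    simp [E]
  have h3 (t : H ⊗[k] (H ⊗[k] H)) : E (Δ3 k H t) = t := by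
    induction t using ind3 with
    | zero => simp
    | add x y hx hy => simp only [map_add, hx, hy]
    | tmul a b c =>
      have : ∀ s : H ⊗[k] H, E (a ⊗ₜ (b ⊗ₜ s)) = a ⊗ₜ (b ⊗ₜ
          Algebra.TensorProduct.lid k H (Algebra.TensorProduct.map ε (AlgHom.id k H) s)) := by
        intro s
        induction s with
        | zero => simp
        | add x y hx hy => simp only [map_add, TensorProduct.tmul_add, hx, hy]
        | tmul x y => simp [hE]
      refine (this (Δ c)).trans ?_
      rw [counit_left]
  have h2 (t : H ⊗[k] (H ⊗[k] H)) : E (Δ2 k H t) = t := by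
    induction t using ind3 with
    | zero => simp
    | add x y hx hy => simp only [map_add, hx, hy]
    | tmul a b c =>
      have : ∀ s : H ⊗[k] H, E (a ⊗ₜ (Algebra.TensorProduct.assoc k k k H H H (s ⊗ₜ c))) =
          a ⊗ₜ (Algebra.TensorProduct.rid k k H (Algebra.TensorProduct.map (AlgHom.id k H) ε s)
            ⊗ₜ c) := by
        intro s
        induction s with
        | zero => simp
        | add x y hx hy => simp only [map_add, TensorProduct.tmul_add, TensorProduct.add_tmul, hx, hy]
        | tmul x y => simp [hE, TensorProduct.smul_tmul]
      refine (this (Δ b)).trans ?_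
      rw [counit_right]
  have h1 : E (Δ1 k H φ.val) = 1 := by
    have : ∀ t : H ⊗[k] (H ⊗[k] H), E (Δ1 k H t) =
        Algebra.TensorProduct.assoc k k k H H H (Algebra.TensorProduct.map Δ (AlgHom.id k H)
          (ε2 k H t)) := by
      intro t
      induction t using ind3 with
      | zero => simp
      | add x y hx hy => simp only [map_add, hx, hy]
      | tmul a b c =>
        have : ∀ s : H ⊗[k] H, E (Algebra.TensorProduct.assoc k k k H H (H ⊗[k] H)
            (s ⊗ₜ (b ⊗ₜ c))) = ε (k := k) b • Algebra.TensorProduct.assoc k k k H H H (s ⊗ₜ c) := by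
          intro s
          induction s with
          | zero => simp
          | add x y hx hy => simp only [map_add, TensorProduct.add_tmul, smul_add, hx, hy]
          | tmul x y => simp [hE]
        refine (this (Δ a)).trans ?_
        simp
    rw [this, ε2_φ, map_one, map_one]
  have hl : E (padl k H φ.val) = 1 := by
    refine (Algebra.TensorProduct.map_tmul _ _ _ _).trans ?_
    rw [ε2_φ]
    rfl
  have hp (t : H ⊗[k] (H ⊗[k] H)) : Algebra.TensorProduct.rid k k (H ⊗[k] H)
      (Algebra.TensorProduct.map (AlgHom.id k (H ⊗[k] H)) ε
        ((Algebra.TensorProduct.assoc k k k H H H).symm (E (pad k H t)))) = ε3 k H t := by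
    induction t using ind3 with
    | zero => simp
    | add x y hx hy => simp only [map_add, hx, hy]
    | tmul a b c =>
      have : E (pad k H (a ⊗ₜ (b ⊗ₜ c))) = ε (k := k) c • (a ⊗ₜ (b ⊗ₜ 1)) := hE _ _ _ _
      rw [this]
      simp
  have key := congrArg E (pent (k := k) (H := H))
  rw [map_mul, map_mul, map_mul, h3, h1, hl, h2, mul_one, one_mul] at key
  have : E (pad k H φ.val) = 1 := by
    have h : (φ (k := k) (H := H))⁻¹.val * (φ.val * E (pad k H φ.val)) = 1 := by
      rw [← key]; simp
    rwa [← mul_assoc, Units.inv_mul, one_mul] at h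
  rw [← hp, this]
  simp

theorem ε3_φ_inv : ε3 k H φ⁻¹.val = 1 := by
  have : ε3 k H φ.val * ε3 k H φ⁻¹.val = 1 := by rw [← map_mul]; simp
  rwa [ε3_φ, one_mul] at this

theorem ε2_φ_inv : ε2 k H φ⁻¹.val = 1 := by
  have : ε2 k H φ.val * ε2 k H φ⁻¹.val = 1 := by rw [← map_mul]; simp
  rwa [ε2_φ, one_mul] at this

variable (k H) in
/-- `a ⊗ b ⊗ c ⊗ d ↦ a ⊗ b β S(c) α d` -/
noncomputable def Q : H ⊗[k] (H ⊗[k] (H ⊗[k] H)) →ₗ[k] H ⊗[k] H :=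
  TensorProduct.map LinearMap.id (mβα k H)

variable (k H) in
/-- `a ⊗ b ⊗ c ⊗ d ↦ a ⊗ S(b) α c β S(d)` -/
noncomputable def R : H ⊗[k] (H ⊗[k] (H ⊗[k] H)) →ₗ[k] H ⊗[k] H :=
  TensorProduct.map LinearMap.id (mαβ k H)

theorem Q_tmul (a b c d : H) : Q k H (a ⊗ₜ (b ⊗ₜ (c ⊗ₜ d))) =
    a ⊗ₜ (b * β k * (S (k := k) c * α k * d)) := rfl

theorem R_tmul (a b c d : H) : R k H (a ⊗ₜ (b ⊗ₜ (c ⊗ₜ d))) =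
    a ⊗ₜ (S (k := k) b * α k * (c * β k * S (k := k) d)) := rfl

theorem Q_padl : Q k H (padl k H φ.val) = 1 := by
  refine (TensorProduct.map_tmul _ _ _ _).trans ?_
  have : mβα k H φ.val = 1 := antipode_φ
  rw [this]
  rfl

theorem R_padl : R k H (padl k H φ⁻¹.val) = 1 := by
  refine (TensorProduct.map_tmul _ _ _ _).trans ?_
  have : mαβ k H φ⁻¹.val = 1 := antipode_φ_inv
  rw [this]
  rfl

theorem Q_Δ3 (x : H ⊗[k] (H ⊗[k] H)) (y : H ⊗[k] (H ⊗[k] (H ⊗[k] H))) :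
    Q k H (Δ3 k H x * y) = ε3 k H x * Q k H y := by
  induction y using ind4 with
  | zero => simp
  | add y z hy hz => simp only [mul_add, map_add, hy, hz]
  | tmul p q r s =>
    induction x using ind3 with
    | zero => simp
    | add y z hy hz => simp only [add_mul, map_add, hy, hz]
    | tmul a b c =>
      have : ∀ t : H ⊗[k] H, Q k H ((a ⊗ₜ (b ⊗ₜ t)) * (p ⊗ₜ (q ⊗ₜ (r ⊗ₜ s)))) =
          (a * p) ⊗ₜ (b * q * β k * (S (k := k) r * mα k H t * s)) := by
        intro t
        induction t with
        | zero => simp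
        | add y z hy hz => simp only [TensorProduct.tmul_add, add_mul, mul_add, map_add, hy, hz]
        | tmul c d => simp [Q_tmul, S_mul, mul_assoc]
      refine (this (Δ c)).trans ?_
      simp [mα_Δ, Q_tmul, mul_assoc]

theorem Q_Δ2 (x : H ⊗[k] (H ⊗[k] H)) (y : H ⊗[k] (H ⊗[k] (H ⊗[k] H))) :
    Q k H (y * Δ2 k H x) = Q k H y * ε2 k H x := by
  induction y using ind4 with
  | zero => simp
  | add y z hy hz => simp only [add_mul, map_add, hy, hz]
  | tmul p q r s =>
    induction x using ind3 with
    | zero => simp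
    | add y z hy hz => simp only [mul_add, map_add, hy, hz]
    | tmul a b c =>
      have : ∀ t : H ⊗[k] H, Q k H ((p ⊗ₜ (q ⊗ₜ (r ⊗ₜ s))) *
          (a ⊗ₜ Algebra.TensorProduct.assoc k k k H H H (t ⊗ₜ c))) =
          (p * a) ⊗ₜ (q * mβ k H t * (S (k := k) r * α k * s * c)) := by
        intro t
        induction t with
        | zero => simp
        | add y z hy hz =>
          simp only [TensorProduct.tmul_add, TensorProduct.add_tmul, add_mul, mul_add, map_add,
            hy, hz]
        | tmul c d => simp [Q_tmul, S_mul, mul_assoc]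
      refine (this (Δ b)).trans ?_
      simp [mβ_Δ, Q_tmul, mul_assoc]

theorem Q_main : Q k H (Δ1 k H φ.val * pad k H φ⁻¹.val) = 1 := by
  rw [pent1, Q_Δ3, Q_Δ2, Q_padl, ε3_φ_inv, ε2_φ, one_mul, one_mul]

/-- `a ⊗ c ↦ (a ⊗ 1) z (1 ⊗ S(c))` -/
noncomputable def NL (z : H ⊗[k] H) : H ⊗[k] H →ₗ[k] H ⊗[k] H :=
  TensorProduct.lift (LinearMap.mk₂ k
    (fun a c => (a ⊗ₜ[k] (1 : H)) * z * ((1 : H) ⊗ₜ[k] S (k := k) c))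
    (fun a b c => by simp only [TensorProduct.add_tmul, add_mul])
    (fun a b c => by simp only [← TensorProduct.smul_tmul', smul_mul_assoc])
    (fun a b c => by simp only [map_add, TensorProduct.tmul_add, mul_add])
    (fun a b c => by simp only [map_smul, TensorProduct.tmul_smul, mul_smul_comm]))

/-- `a ⊗ b ↦ (1 ⊗ S(b)) z (a ⊗ 1)` -/
noncomputable def NR (z : H ⊗[k] H) : H ⊗[k] H →ₗ[k] H ⊗[k] H :=
  TensorProduct.lift (LinearMap.mk₂ k
    (fun a b => ((1 : H) ⊗ₜ[k] S (k := k) b) * z * (a ⊗ₜ[k] (1 : H)))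
    (fun a b c => by simp only [TensorProduct.add_tmul, mul_add])
    (fun a b c => by simp only [← TensorProduct.smul_tmul', mul_smul_comm])
    (fun a b c => by simp only [map_add, TensorProduct.tmul_add, add_mul])
    (fun a b c => by simp only [map_smul, TensorProduct.tmul_smul, smul_mul_assoc]))

theorem NL_tmul (z : H ⊗[k] H) (a c : H) :
    NL z (a ⊗ₜ c) = (a ⊗ₜ[k] (1 : H)) * z * ((1 : H) ⊗ₜ[k] S (k := k) c) := rfl

theorem NR_tmul (z : H ⊗[k] H) (a b : H) :
    NR z (a ⊗ₜ b) = ((1 : H) ⊗ₜ[k] S (k := k) b) * z * (a ⊗ₜ[k] (1 : H)) := rfl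

theorem NL_one (z : H ⊗[k] H) : NL z 1 = z := by
  rw [Algebra.TensorProduct.one_def, NL_tmul, S_one, ← Algebra.TensorProduct.one_def, one_mul,
    mul_one]

theorem NR_one (z : H ⊗[k] H) : NR z 1 = z := by
  rw [Algebra.TensorProduct.one_def, NR_tmul, S_one, ← Algebra.TensorProduct.one_def, one_mul,
    mul_one]

theorem R_Δ2 (x : H ⊗[k] (H ⊗[k] H)) (y : H ⊗[k] (H ⊗[k] (H ⊗[k] H))) :
    R k H (Δ2 k H x * y) = NL (R k H y) (ε2 k H x) := by
  induction x using ind3 with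
  | zero => simp
  | add y z hy hz => simp only [add_mul, map_add, hy, hz]
  | tmul a b c =>
    simp only [ε2_tmul, map_smul, NL_tmul]
    induction y using ind4 with
    | zero => simp
    | add y z hy hz => simp only [mul_add, add_mul, map_add, smul_add, hy, hz]
    | tmul p q r s =>
      have : ∀ t : H ⊗[k] H, R k H ((a ⊗ₜ Algebra.TensorProduct.assoc k k k H H H (t ⊗ₜ c)) *
          (p ⊗ₜ (q ⊗ₜ (r ⊗ₜ s)))) =
          (a * p) ⊗ₜ (S (k := k) q * mα k H t * (r * β k * S (k := k) s * S (k := k) c)) := by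
        intro t
        induction t with
        | zero => simp
        | add y z hy hz =>
          simp only [TensorProduct.tmul_add, TensorProduct.add_tmul, add_mul, mul_add, map_add,
            hy, hz]
        | tmul c d => simp [R_tmul, S_mul, mul_assoc]
      refine (this (Δ b)).trans ?_
      simp [mα_Δ, R_tmul, mul_assoc]

theorem R_Δ3 (x : H ⊗[k] (H ⊗[k] H)) (y : H ⊗[k] (H ⊗[k] (H ⊗[k] H))) :
    R k H (y * Δ3 k H x) = NR (R k H y) (ε3 k H x) := by
  induction x using ind3 with
  | zero => simp
  | add y z hy hz => simp only [mul_add, map_add, hy, hz]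
  | tmul a b c =>
    simp only [ε3_tmul, map_smul, NR_tmul]
    induction y using ind4 with
    | zero => simp
    | add y z hy hz => simp only [mul_add, add_mul, map_add, smul_add, hy, hz]
    | tmul p q r s =>
      have : ∀ t : H ⊗[k] H, R k H ((p ⊗ₜ (q ⊗ₜ (r ⊗ₜ s))) * (a ⊗ₜ (b ⊗ₜ t))) =
          (p * a) ⊗ₜ (S (k := k) b * S (k := k) q * α k * (r * mβ k H t * S (k := k) s)) := by
        intro t
        induction t with
        | zero => simp
        | add y z hy hz => simp only [TensorProduct.tmul_add, add_mul, mul_add, map_add, hy, hz]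
        | tmul c d => simp [R_tmul, S_mul, mul_assoc]
      refine (this (Δ c)).trans ?_
      simp [mβ_Δ, R_tmul, mul_assoc]

theorem R_main : R k H (pad k H φ.val * Δ1 k H φ⁻¹.val) = 1 := by
  rw [pent2, R_Δ2, R_Δ3, R_padl, ε3_φ, ε2_φ_inv, NL_one, NR_one]

end Closed

section Hom

set_option maxSynthPendingDepth 8

open QuasiHopfAlgebra

variable {k H : Type u} [CommRing k] [Ring H] [Algebra k H] [QuasiHopfAlgebra k H]

section Sandwich

variable {A B V W : Type u} [Ring A] [Algebra k A] [Ring B] [Algebra k B]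
  [AddCommGroup V] [Module k V] [AddCommGroup W] [Module k W]

/-- `a ⊗ b` sends `L` to `(a ▷ ·) ∘ L ∘ (b ▷ ·)`. -/
noncomputable def sand (f : H →ₐ[k] Module.End k W) (g : H →ₐ[k] Module.End k V) :
    H ⊗[k] H →ₗ[k] Module.End k (V →ₗ[k] W) :=
  TensorProduct.lift (LinearMap.mk₂ k
    (fun a b =>
      { toFun := fun L => f a ∘ₗ L ∘ₗ g b
        map_add' := fun L L' => by rw [LinearMap.add_comp, LinearMap.comp_add]
        map_smul' := fun c L => by rw [LinearMap.smul_comp, LinearMap.comp_smul]; rfl })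
    (fun a a' b => by ext L; simp)
    (fun c a b => by ext L; simp)
    (fun a b b' => by ext L; simp)
    (fun c a b => by ext L; simp))

@[simp] theorem sand_tmul (f : H →ₐ[k] Module.End k W) (g : H →ₐ[k] Module.End k V) (a b : H)
    (L : V →ₗ[k] W) (v : V) : sand f g (a ⊗ₜ b) L v = f a (L (g b v)) := rfl

end Sandwich

variable (k H) in
/-- `id ⊗ S` -/
noncomputable def idS : H ⊗[k] H →ₗ[k] H ⊗[k] H :=
  TensorProduct.map LinearMap.id (S (k := k) (H := H)).toLinearMap

@[simp] theorem idS_tmul (a b : H) : idS k H (a ⊗ₜ b) = a ⊗ₜ S (k := k) b := rfl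

theorem sand_idS_mul {V W : HRep k H} (x y : H ⊗[k] H) :
    sand W.ρ V.ρ (idS k H (x * y)) = sand W.ρ V.ρ (idS k H x) * sand W.ρ V.ρ (idS k H y) := by
  induction x with
  | zero => simp
  | add x x' hx hx' => simp only [add_mul, map_add, hx, hx']
  | tmul a b =>
    induction y with
    | zero => simp
    | add x x' hx hx' => simp only [mul_add, map_add, hx, hx']
    | tmul c d =>
      ext L v
      simp [S_mul]

/-- The adjoint action `h ▷ L = (h₁ ▷ ·) ∘ L ∘ (S(h₂) ▷ ·)` on `k`-linear maps `V → W`. -/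
noncomputable def adj (V W : HRep k H) : H →ₐ[k] Module.End k (V →ₗ[k] W) :=
  AlgHom.ofLinearMap (sand W.ρ V.ρ ∘ₗ idS k H ∘ₗ (Δ (k := k) (H := H)).toLinearMap)
    (by
      ext L v
      simp [Algebra.TensorProduct.one_def, S_one])
    (fun x y => by
      simp only [LinearMap.comp_apply, AlgHom.toLinearMap_apply, map_mul, sand_idS_mul])

/-- The internal hom object: all `k`-linear maps `V → W`, with the adjoint action. -/
noncomputable def ihom (V W : HRep k H) : HRep k H where
  carrier := V →ₗ[k] W
  ρ := adj V W

theorem adj_apply (V W : HRep k H) (h : H) (L : V →ₗ[k] W) :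
    adj V W h L = sand W.ρ V.ρ (idS k H (Δ h)) L := rfl

variable (k H) in
/-- `a ⊗ b ⊗ c ↦ a ⊗ b β S(c)` -/
noncomputable def Kmap : H ⊗[k] (H ⊗[k] H) →ₗ[k] H ⊗[k] H := TensorProduct.map LinearMap.id (mβ k H)

variable (k H) in
/-- `a ⊗ b ⊗ c ↦ a ⊗ S(b) α c` -/
noncomputable def Lmap : H ⊗[k] (H ⊗[k] H) →ₗ[k] H ⊗[k] H := TensorProduct.map LinearMap.id (mα k H)

@[simp] theorem Kmap_tmul (a b c : H) :
    Kmap k H (a ⊗ₜ (b ⊗ₜ c)) = a ⊗ₜ (b * β k * S (k := k) c) := rfl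
@[simp] theorem Lmap_tmul (a b c : H) :
    Lmap k H (a ⊗ₜ (b ⊗ₜ c)) = a ⊗ₜ (S (k := k) b * α k * c) := rfl

/-- The underlying linear map of the currying of `f : V ⊗ W → X`:
`v ↦ f((φ⁻¹ ▷ v) ⊗ (φ⁻² β S(φ⁻³) ▷ ·))`, with the legs of the inverse of `φ`. -/
noncomputable def curryLin {V W X : HRep k H} (f : V ⊗[k] W →ₗ[k] X) : V →ₗ[k] (W →ₗ[k] X) :=
  TensorProduct.curry (f ∘ₗ actT V.ρ W.ρ (Kmap k H φ⁻¹.val))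

theorem curryLin_apply {V W X : HRep k H} (f : V ⊗[k] W →ₗ[k] X) (v : V) (w : W) :
    curryLin f v w = f (actT V.ρ W.ρ (Kmap k H φ⁻¹.val) (v ⊗ₜ[k] w)) := rfl

theorem Kmap_left (s : H ⊗[k] H) (c : H) (y : H ⊗[k] (H ⊗[k] H)) :
    Kmap k H (Algebra.TensorProduct.assoc k k k H H H (s ⊗ₜ c) * y) =
      s * Kmap k H y * (1 ⊗ₜ S (k := k) c) := by
  induction y using ind3 with
  | zero => simp
  | add x y hx hy => simp only [mul_add, add_mul, map_add, hx, hy]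
  | tmul p q r =>
    induction s with
    | zero => simp
    | add x y hx hy => simp only [TensorProduct.add_tmul, add_mul, map_add, hx, hy]
    | tmul a b => simp [S_mul, mul_assoc]

theorem Kmap_right (s : H ⊗[k] H) (y : H ⊗[k] (H ⊗[k] H)) :
    Kmap k H (y * Algebra.TensorProduct.map (AlgHom.id k H) Δ s) =
      Kmap k H y * (Algebra.TensorProduct.rid k k H
        (Algebra.TensorProduct.map (AlgHom.id k H) ε s) ⊗ₜ 1) := by
  induction y using ind3 with
  | zero => simp
  | add x y hx hy => simp only [add_mul, map_add, hx, hy]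
  | tmul p q r =>
    induction s with
    | zero => simp
    | add x y hx hy => simp only [TensorProduct.add_tmul, mul_add, map_add, hx, hy]
    | tmul a b =>
      have : ∀ t : H ⊗[k] H, Kmap k H ((p ⊗ₜ (q ⊗ₜ r)) * (a ⊗ₜ t)) =
          (p * a) ⊗ₜ (q * mβ k H t * S (k := k) r) := by
        intro t
        induction t with
        | zero => simp
        | add x y hx hy => simp only [TensorProduct.tmul_add, mul_add, add_mul, map_add, hx, hy]
        | tmul c d => simp [S_mul, mul_assoc]
      rw [Algebra.TensorProduct.map_tmul, AlgHom.id_apply, this, mβ_Δ]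
      simp [TensorProduct.smul_tmul]

theorem Lmap_left (s : H ⊗[k] H) (y : H ⊗[k] (H ⊗[k] H)) :
    Lmap k H (Algebra.TensorProduct.map (AlgHom.id k H) Δ s * y) =
      (Algebra.TensorProduct.rid k k H
        (Algebra.TensorProduct.map (AlgHom.id k H) ε s) ⊗ₜ 1) * Lmap k H y := by
  induction y using ind3 with
  | zero => simp
  | add x y hx hy => simp only [mul_add, map_add, hx, hy]
  | tmul p q r =>
    induction s with
    | zero => simp
    | add x y hx hy => simp only [TensorProduct.add_tmul, add_mul, map_add, hx, hy]
    | tmul a b =>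
      have : ∀ t : H ⊗[k] H, Lmap k H ((a ⊗ₜ t) * (p ⊗ₜ (q ⊗ₜ r))) =
          (a * p) ⊗ₜ (S (k := k) q * mα k H t * r) := by
        intro t
        induction t with
        | zero => simp
        | add x y hx hy => simp only [TensorProduct.tmul_add, mul_add, add_mul, map_add, hx, hy]
        | tmul c d => simp [S_mul, mul_assoc]
      rw [Algebra.TensorProduct.map_tmul, AlgHom.id_apply, this, mα_Δ]
      simp [TensorProduct.smul_tmul]

theorem curry_comm_aux {V W X : HRep k H} (f : V ⊗[k] W →ₗ[k] X)
    (hf : ∀ (h : H) (x : V ⊗[k] W), f (actT V.ρ W.ρ (Δ h) x) = X.ρ h (f x)) (t : H ⊗[k] H) (v : V) (w : W) :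
    sand X.ρ W.ρ (idS k H t) (curryLin f v) w =
      f (actT V.ρ W.ρ (Kmap k H (Algebra.TensorProduct.assoc k k k H H H
        (Algebra.TensorProduct.map Δ (AlgHom.id k H) t) * φ⁻¹.val)) (v ⊗ₜ[k] w)) := by
  induction t with
  | zero => simp
  | add x y hx hy => simp only [map_add, add_mul, LinearMap.add_apply, hx, hy]
  | tmul a c =>
    rw [idS_tmul, sand_tmul, curryLin_apply, ← hf, Algebra.TensorProduct.map_tmul,
      Kmap_left, map_mul, map_mul, Module.End.mul_apply, Module.End.mul_apply, AlgHom.id_apply]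
    simp

theorem curry_comm {V W X : HRep k H} (f : V ⊗[k] W →ₗ[k] X)
    (hf : ∀ (h : H) (x : V ⊗[k] W), f (actT V.ρ W.ρ (Δ h) x) = X.ρ h (f x)) (h : H) (v : V) :
    curryLin f (V.ρ h v) = adj W X h (curryLin f v) := by
  ext w
  rw [adj_apply, curry_comm_aux _ hf]
  have : Algebra.TensorProduct.assoc k k k H H H
        (Algebra.TensorProduct.map Δ (AlgHom.id k H) (Δ h)) * φ⁻¹.val =
      φ⁻¹.val * Algebra.TensorProduct.map (AlgHom.id k H) (Δ (k := k)) (Δ h) := by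
    rw [Units.eq_inv_mul_iff_mul_eq, ← mul_assoc, ← quasi_coassoc, mul_assoc, Units.mul_inv,
      mul_one]
  rw [this, Kmap_right, counit_right, map_mul, Module.End.mul_apply, curryLin_apply]
  simp

/-- The currying of `f`, an equivariant map `V → hom(W, X)`. -/
noncomputable def curry {V W X : HRep k H} (f : V ⊗ W ⟶ X) : V ⟶ ihom W X :=
  ⟨curryLin f.toLin, curry_comm f.toLin f.comm⟩

/-- The underlying linear map of the evaluation:
`L ⊗ v ↦ φ¹ ▷ L((S(φ²) α φ³) ▷ v)`. -/
noncomputable def evLin (V W : HRep k H) : (V →ₗ[k] W) ⊗[k] V →ₗ[k] W :=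
  TensorProduct.lift (sand W.ρ V.ρ (Lmap k H φ.val))

@[simp] theorem evLin_tmul (V W : HRep k H) (L : V →ₗ[k] W) (v : V) :
    evLin V W (L ⊗ₜ v) = sand W.ρ V.ρ (Lmap k H φ.val) L v := rfl

theorem ev_comm_aux (V W : HRep k H) (y : H ⊗[k] (H ⊗[k] H)) (t : H ⊗[k] H) (c : H)
    (L : V →ₗ[k] W) (v : V) :
    sand W.ρ V.ρ (Lmap k H y) (sand W.ρ V.ρ (idS k H t) L) (V.ρ c v) =
      sand W.ρ V.ρ (Lmap k H (y * Algebra.TensorProduct.assoc k k k H H H (t ⊗ₜ c))) L v := by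
  induction y using ind3 with
  | zero => simp
  | add x y hx hy => simp only [add_mul, map_add, LinearMap.add_apply, hx, hy]
  | tmul p q r =>
    induction t with
    | zero => simp
    | add x y hx hy =>
      simp only [TensorProduct.add_tmul, mul_add, map_add, LinearMap.add_apply, hx, hy]
    | tmul a b => simp [S_mul]

theorem sand_left (V W : HRep k H) (a : H) (z : H ⊗[k] H) (L : V →ₗ[k] W) (v : V) :
    sand W.ρ V.ρ ((a ⊗ₜ 1) * z) L v = W.ρ a (sand W.ρ V.ρ z L v) := by
  induction z with
  | zero => simp
  | add x y hx hy => simp only [mul_add, map_add, LinearMap.add_apply, hx, hy]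
  | tmul p q => simp

theorem sand_one (V W : HRep k H) (L : W →ₗ[k] V) (w : W) : sand V.ρ W.ρ 1 L w = L w := by
  rw [Algebra.TensorProduct.one_def, sand_tmul, map_one, map_one]
  rfl

theorem ev_comm (V W : HRep k H) (h : H) (x : (V →ₗ[k] W) ⊗[k] V) :
    evLin V W (actT (adj V W) V.ρ (Δ h) x) = W.ρ h (evLin V W x) := by
  induction x with
  | zero => simp
  | add x y hx hy => simp only [map_add, hx, hy]
  | tmul L v =>
    have h1 : ∀ t : H ⊗[k] H, evLin V W (actT (adj V W) V.ρ t (L ⊗ₜ v)) =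
        sand W.ρ V.ρ (Lmap k H (φ.val * Algebra.TensorProduct.assoc k k k H H H
          (Algebra.TensorProduct.map Δ (AlgHom.id k H) t))) L v := by
      intro t
      induction t with
      | zero => simp
      | add x y hx hy => simp only [mul_add, map_add, LinearMap.add_apply, hx, hy]
      | tmul a b => exact ev_comm_aux V W φ.val (Δ a) b L v
    rw [h1, ← quasi_coassoc, Lmap_left, counit_right, sand_left, evLin_tmul]

/-- Evaluation. -/
noncomputable def ev (V W : HRep k H) : ihom V W ⊗ V ⟶ W :=
  ⟨evLin V W, ev_comm V W⟩

theorem uncurry_curry_aux {V W X : HRep k H} (f : V ⊗[k] W →ₗ[k] X)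
    (hf : ∀ (h : H) (x : V ⊗[k] W), f (actT V.ρ W.ρ (Δ h) x) = X.ρ h (f x)) (s : H ⊗[k] (H ⊗[k] H))
    (v : V) (w : W) :
    sand X.ρ W.ρ (Lmap k H s) (curryLin f v) w =
      f (actT V.ρ W.ρ (Q k H (Δ1 k H s * pad k H φ⁻¹.val)) (v ⊗ₜ[k] w)) := by
  induction s using ind3 with
  | zero => simp
  | add x y hx hy => simp only [map_add, add_mul, LinearMap.add_apply, hx, hy]
  | tmul a b c =>
    rw [Lmap_tmul, sand_tmul, curryLin_apply, ← hf, ← Module.End.mul_apply, ← map_mul]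
    have key : ∀ (u : H ⊗[k] H) (t : H ⊗[k] (H ⊗[k] H)),
        Q k H (Algebra.TensorProduct.assoc k k k H H (H ⊗[k] H) (u ⊗ₜ (b ⊗ₜ c)) * pad k H t) =
          u * Kmap k H t * (1 ⊗ₜ (S (k := k) b * α k * c)) := by
      intro u t
      induction t using ind3 with
      | zero => simp
      | add x y hx hy => simp only [map_add, mul_add, add_mul, hx, hy]
      | tmul p q r =>
        induction u with
        | zero => simp
        | add x y hx hy => simp only [TensorProduct.add_tmul, map_add, add_mul, hx, hy]
        | tmul x y => simp [pad, Q_tmul, S_mul, mul_assoc]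
    have := key (Δ a) φ⁻¹.val
    refine Eq.trans ?_ (congrArg (fun z => f (actT V.ρ W.ρ z (v ⊗ₜ[k] w))) this.symm)
    simp only [map_mul, Module.End.mul_apply]
    simp

theorem ev_curry {V W X : HRep k H} (f : V ⊗ W ⟶ X) :
    curry f ▷ W ≫ ev W X = f := by
  refine tensor_ext fun v w => ?_
  refine (uncurry_curry_aux f.toLin f.comm φ.val v w).trans ?_
  rw [Q_main, map_one]
  rfl

theorem curry_ev_aux {V W : HRep k H} (s t : H ⊗[k] (H ⊗[k] H)) (L : V →ₗ[k] W) (w : V) :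
    TensorProduct.lift (sand W.ρ V.ρ (Lmap k H s)) (actT (adj V W) V.ρ (Kmap k H t) (L ⊗ₜ w)) =
      sand W.ρ V.ρ (R k H (pad k H s * Δ1 k H t)) L w := by
  induction t using ind3 with
  | zero => simp
  | add x y hx hy => simp only [map_add, mul_add, LinearMap.add_apply, hx, hy]
  | tmul a b c =>
    have key : ∀ u : H ⊗[k] H, sand W.ρ V.ρ (Lmap k H s) (sand W.ρ V.ρ (idS k H u) L)
        (V.ρ (b * β k * S (k := k) c) w) = sand W.ρ V.ρ (R k H (pad k H s *
          Algebra.TensorProduct.assoc k k k H H (H ⊗[k] H) (u ⊗ₜ (b ⊗ₜ c)))) L w := by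
      intro u
      induction s using ind3 with
      | zero => simp
      | add x y hx hy => simp only [map_add, add_mul, LinearMap.add_apply, hx, hy]
      | tmul p q r =>
        induction u with
        | zero => simp
        | add x y hx hy =>
          simp only [TensorProduct.add_tmul, map_add, mul_add, LinearMap.add_apply, hx, hy]
        | tmul x y => simp [pad, R_tmul, S_mul, mul_assoc]
    exact key (Δ a)

theorem curry_ev {V W X : HRep k H} (g : V ⟶ ihom W X) : curry (g ▷ W ≫ ev W X) = g := by
  have h1 : curry (ev W X) = 𝟙 (ihom W X) := hom_ext fun L => LinearMap.ext fun w => by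
    refine (curry_ev_aux φ.val φ⁻¹.val L w).trans ?_
    rw [R_main]
    exact sand_one X W L w
  have h2 : curry (g ▷ W ≫ ev W X) = g ≫ curry (ev W X) := hom_ext fun v => by
    refine LinearMap.ext fun w => ?_
    have := actT_nat g.toLin LinearMap.id (AlgHom.id k H) (AlgHom.id k H) g.comm (fun _ _ => rfl)
      (Kmap k H φ⁻¹.val) (v ⊗ₜ[k] w) (g' := W.ρ)
    rw [Algebra.TensorProduct.map_id] at this
    exact congrArg (evLin W X) this
  rw [h2, h1, Category.comp_id]

theorem ihom_ext {V W X : HRep k H} {f g : V ⟶ ihom W X}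
    (h : f ▷ W ≫ ev W X = g ▷ W ≫ ev W X) : f = g := by
  rw [← curry_ev f, h, curry_ev]

end Hom

section Colimits

open CategoryTheory.Limits

variable {k H : Type u} [CommRing k] [Ring H] [Algebra k H]

/-- The module over the ring `H` underlying an object of `HRep k H`. -/
noncomputable def toModObj (V : HRep k H) : ModuleCat.{u} H :=
  letI : Module H V.carrier := Module.compHom V.carrier V.ρ.toRingHom
  ModuleCat.of H V.carrier

theorem toModObj_smul (V : HRep k H) (h : H) (v : V) :
    (letI x : toModObj V := v; h • x) = V.ρ h v := rfl

theorem ρ_algebraMap (V : HRep k H) (c : k) (v : V) : V.ρ (algebraMap k H c) v = c • v := by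
  rw [AlgHom.commutes]; rfl

variable (k H) in
/-- The equivalence with the category of modules over the ring `H`. -/
noncomputable def toMod : HRep k H ⥤ ModuleCat.{u} H where
  obj := toModObj
  map {V W} f := ModuleCat.ofHom (X := toModObj V) (Y := toModObj W)
    { toFun := fun v => f.toLin v
      map_add' := fun v w => f.toLin.map_add v w
      map_smul' := fun h v => f.comm h v }

/-- The object of `HRep k H` defined by a module over the ring `H`. -/
noncomputable def ofModObj (M : ModuleCat.{u} H) : HRep k H :=
  letI : Module k M := Module.compHom M (algebraMap k H)
  haveI : IsScalarTower k H M := ⟨fun c h m => by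
    rw [Algebra.smul_def, mul_smul]; rfl⟩
  { carrier := M
    ρ := Algebra.lsmul k k M }

instance : (toMod k H).Faithful where
  map_injective {V W} _ _ h := hom_ext fun v =>
    congrArg (fun q : toModObj V ⟶ toModObj W => q.hom (v : toModObj V)) h

instance : (toMod k H).Full where
  map_surjective {V W} f := ⟨⟨
    { toFun := fun v => f.hom (v : toModObj V)
      map_add' := fun v w => f.hom.map_add v w
      map_smul' := fun c v => by
        have := f.hom.map_smul (algebraMap k H c) (v : toModObj V)
        refine Eq.trans (congrArg f.hom (ρ_algebraMap V c v).symm) (this.trans ?_)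
        exact ρ_algebraMap W c _ }, fun h v => f.hom.map_smul h (v : toModObj V)⟩, rfl⟩

instance : (toMod k H).EssSurj where
  mem_essImage M := ⟨ofModObj M, ⟨LinearEquiv.toModuleIso (m₁ := (toModObj (ofModObj (k := k) M)).isModule)
    { toFun := fun m => m
      invFun := fun m => m
      map_add' := fun _ _ => rfl
      map_smul' := fun _ _ => rfl
      left_inv := fun _ => rfl
      right_inv := fun _ => rfl }⟩⟩

instance : (toMod k H).IsEquivalence where

instance : HasColimitsOfSize.{0, 0} (HRep k H) :=
  Adjunction.has_colimits_of_equivalence (toMod k H)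

variable (k H) in
/-- The functor that forgets the action. -/
def forgetMod : HRep k H ⥤ ModuleCat.{u} k where
  obj V := ModuleCat.of k V
  map f := ModuleCat.ofHom f.toLin

variable (k H) in
/-- Forgetting the action is restriction of scalars. -/
noncomputable def toModRestrict :
    toMod k H ⋙ ModuleCat.restrictScalars (algebraMap k H) ≅ forgetMod k H :=
  NatIso.ofComponents (fun V => LinearEquiv.toModuleIso
    (m₁ := ((ModuleCat.restrictScalars (algebraMap k H)).obj (toModObj V)).isModule)
    { toFun := fun m => m
      invFun := fun m => m
      map_add' := fun _ _ => rfl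
      map_smul' := fun c v => by
        refine Eq.trans (ModuleCat.restrictScalars.smul_def (algebraMap k H) c v) ?_
        exact ρ_algebraMap V c v
      left_inv := fun _ => rfl
      right_inv := fun _ => rfl })
    (fun f => rfl)

instance : PreservesColimitsOfSize.{0, 0} (forgetMod k H) :=
  haveI : PreservesColimitsOfSize.{0, 0} (ModuleCat.restrictScalars.{u} (algebraMap k H)) :=
    (ModuleCat.restrictCoextendScalarsAdj (algebraMap k H)).leftAdjoint_preservesColimits
  preservesColimits_of_natIso (toModRestrict k H)

instance : (forgetMod k H).ReflectsIsomorphisms where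
  reflects {V W} f hf := by
    let e := (asIso ((forgetMod k H).map f)).toLinearEquiv
    exact ⟨(isoOfLin e f.comm).inv, (isoOfLin e f.comm).hom_inv_id,
      (isoOfLin e f.comm).inv_hom_id⟩

instance : ReflectsColimitsOfSize.{0, 0} (forgetMod k H) :=
  reflectsColimits_of_reflectsIsomorphisms

instance [QuasiHopfAlgebra k H] (X : HRep k H) :
    PreservesColimitsOfSize.{0, 0} (tensorLeft X) :=
  haveI : PreservesColimitsOfSize.{0, 0} (tensorLeft X ⋙ forgetMod k H) :=
    preservesColimits_of_natIso (F := forgetMod k H ⋙ tensorLeft ((forgetMod k H).obj X))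
      (NatIso.ofComponents (fun _ => Iso.refl _) (fun _ => rfl))
  preservesColimits_of_reflects_of_preserves (tensorLeft X) (forgetMod k H)

instance [QuasiHopfAlgebra k H] (X : HRep k H) :
    PreservesColimitsOfSize.{0, 0} (tensorRight X) :=
  haveI : PreservesColimitsOfSize.{0, 0} (tensorRight X ⋙ forgetMod k H) :=
    preservesColimits_of_natIso (F := forgetMod k H ⋙ tensorRight ((forgetMod k H).obj X))
      (NatIso.ofComponents (fun _ => Iso.refl _) (fun _ => rfl))
  preservesColimits_of_reflects_of_preserves (tensorRight X) (forgetMod k H)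

/-- The monoidal category of `A`-bimodules, with the tensor product over `A`. -/
noncomputable instance [QuasiHopfAlgebra k H] (A : Mon (HRep k H)) :
    MonoidalCategory (Bimod A A) where
  tensorObj M N := M.tensorBimod N
  whiskerLeft M _ _ f := Bimod.whiskerLeft M f
  whiskerRight f N := Bimod.whiskerRight f N
  tensorUnit := Bimod.regular A
  associator := Bimod.associatorBimod
  leftUnitor := Bimod.leftUnitorBimod
  rightUnitor := Bimod.rightUnitorBimod
  tensorHom_comp_tensorHom _ _ _ _ := by
    dsimp only
    rw [Bimod.whiskerLeft_comp_bimod, Bimod.comp_whiskerRight_bimod, Category.assoc,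
      Category.assoc, ← Category.assoc (Bimod.whiskerLeft _ _) (Bimod.whiskerRight _ _),
      Bimod.whisker_exchange_bimod, Category.assoc]
  whiskerLeft_id _ _ := Bimod.whiskerLeft_id_bimod
  id_whiskerRight _ _ := Bimod.id_whiskerRight_bimod
  id_tensorHom_id _ _ := by
    dsimp only
    rw [Bimod.whiskerLeft_id_bimod, Bimod.id_whiskerRight_bimod, Category.comp_id]
  associator_naturality _ _ _ := by
    dsimp only
    rw [Bimod.comp_whiskerRight_bimod, Bimod.whisker_assoc_bimod, Bimod.comp_whiskerLeft_bimod,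
      Bimod.whiskerRight_comp_bimod, Bimod.whiskerLeft_comp_bimod]
    simp only [Category.assoc, Iso.inv_hom_id, Iso.inv_hom_id_assoc, Iso.hom_inv_id_assoc,
      Category.comp_id]
  leftUnitor_naturality f := by
    rw [Bimod.id_whiskerLeft_bimod]; simp
  rightUnitor_naturality f := by
    rw [Bimod.whiskerRight_id_bimod]; simp
  pentagon := Bimod.pentagon_bimod
  triangle := Bimod.triangle_bimod

end Colimits

section Ker

variable {k H : Type u} [CommRing k] [Ring H] [Algebra k H]

/-- The subobject of `V` on which two equivariant maps agree: the kernel of their difference. -/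
noncomputable def ker {V W : HRep k H} (f g : V ⟶ W) : HRep k H where
  carrier := LinearMap.ker (f.toLin - g.toLin)
  ρ := AlgHom.ofLinearMap
    { toFun := fun h => (V.ρ h).restrict fun v hv => by
        rw [LinearMap.mem_ker, LinearMap.sub_apply, sub_eq_zero] at hv ⊢
        rw [f.comm, g.comm, hv]
      map_add' := fun h h' => by ext v; simp
      map_smul' := fun c h => by ext v; simp }
    (by ext v; simp)
    (fun h h' => by ext v; simp)

/-- The inclusion of the kernel. -/
noncomputable def kerι {V W : HRep k H} (f g : V ⟶ W) : ker f g ⟶ V :=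
  ⟨(LinearMap.ker (f.toLin - g.toLin)).subtype, fun _ _ => rfl⟩

theorem kerι_comp {V W : HRep k H} (f g : V ⟶ W) : kerι f g ≫ f = kerι f g ≫ g :=
  hom_ext fun v => sub_eq_zero.1 (LinearMap.mem_ker.1 v.2)

/-- The universal property of the equalizer. -/
noncomputable def kerLift {V W X : HRep k H} {f g : V ⟶ W} (q : X ⟶ V) (hq : q ≫ f = q ≫ g) :
    X ⟶ ker f g :=
  ⟨q.toLin.codRestrict _ fun x => LinearMap.mem_ker.2
      (sub_eq_zero.2 (congrArg (fun p : X ⟶ W => p.toLin x) hq)),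
    fun h x => Subtype.ext (q.comm h x)⟩

theorem kerLift_ι {V W X : HRep k H} {f g : V ⟶ W} (q : X ⟶ V) (hq : q ≫ f = q ≫ g) :
    kerLift q hq ≫ kerι f g = q := rfl

instance {V W : HRep k H} (f g : V ⟶ W) : Mono (kerι f g) where
  right_cancellation _ _ h := hom_ext fun v =>
    Subtype.ext (congrArg (fun r => Hom.toLin r v) h)

end Ker

section HomA

open CategoryTheory.MonObj

variable {k H : Type u} [CommRing k] [Ring H] [Algebra k H] [QuasiHopfAlgebra k H]

/-- Composition of internal homs. -/
noncomputable def comp (V W X : HRep k H) : ihom W X ⊗ ihom V W ⟶ ihom V X :=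
  curry ((α_ _ _ _).hom ≫ ihom W X ◁ ev V W ≫ ev W X)

/-- `L ↦ g ∘ L ∘ f` on linear maps. -/
def ihomMapLin {V V' W W' : HRep k H} (f : V' →ₗ[k] V) (g : W →ₗ[k] W') :
    (V →ₗ[k] W) →ₗ[k] (V' →ₗ[k] W') where
  toFun L := g ∘ₗ L ∘ₗ f
  map_add' L L' := by rw [LinearMap.add_comp, LinearMap.comp_add]
  map_smul' c L := by rw [LinearMap.smul_comp, LinearMap.comp_smul]; rfl

theorem ihomMapLin_sand {V V' W W' : HRep k H} (f : V' ⟶ V) (g : W ⟶ W') (t : H ⊗[k] H)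
    (L : V →ₗ[k] W) (v : V') :
    g.toLin (sand W.ρ V.ρ t L (f.toLin v)) =
      sand W'.ρ V'.ρ t (ihomMapLin f.toLin g.toLin L) v := by
  induction t with
  | zero => simp
  | add x y hx hy => simp only [map_add, LinearMap.add_apply, hx, hy]
  | tmul a b => simp [ihomMapLin, g.comm, f.comm]

/-- `L ↦ g ∘ L ∘ f` on internal homs. -/
def ihomMap {V V' W W' : HRep k H} (f : V' ⟶ V) (g : W ⟶ W') : ihom V W ⟶ ihom V' W' :=
  ⟨ihomMapLin f.toLin g.toLin, fun h L => LinearMap.ext fun v =>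
    ihomMapLin_sand f g (idS k H (QuasiHopfAlgebra.Δ h)) L v⟩

theorem ihomMap_ev {V V' W W' : HRep k H} (f : V' ⟶ V) (g : W ⟶ W') :
    ihomMap f g ▷ V' ≫ ev V' W' = ihom V W ◁ f ≫ ev V W ≫ g :=
  tensor_ext fun L v => (ihomMapLin_sand f g (Lmap k H QuasiHopfAlgebra.φ.val) L v).symm

variable {A : Mon (HRep k H)}

/-- The left action of `A` on a bimodule, curried. -/
noncomputable def lhat (V : Bimod A A) : A.X ⟶ ihom V.X V.X := curry V.actLeft

/-- The left action of `A` on `hom(V, W)`. -/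
noncomputable def homActLeft (V W : Bimod A A) : A.X ⊗ ihom V.X W.X ⟶ ihom V.X W.X :=
  lhat W ▷ ihom V.X W.X ≫ comp V.X W.X W.X

/-- The right action of `A` on `hom(V, W)`. -/
noncomputable def homActRight (V W : Bimod A A) : ihom V.X W.X ⊗ A.X ⟶ ihom V.X W.X :=
  ihom V.X W.X ◁ lhat V ≫ comp V.X V.X W.X

/-- The curried form of `L ⊗ (v ⊗ a) ↦ ev(L ⊗ v a)`. -/
noncomputable def evR (V W : Bimod A A) : ihom V.X W.X ⟶ ihom (V.X ⊗ A.X) W.X :=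
  curry (ihom V.X W.X ◁ V.actRight ≫ ev V.X W.X)

/-- The curried form of `(L ⊗ v) ⊗ a ↦ ev(L ⊗ v) a`, after rebracketing. -/
noncomputable def rEv (V W : Bimod A A) : ihom V.X W.X ⟶ ihom (V.X ⊗ A.X) W.X :=
  curry ((α_ _ _ _).inv ≫ ev V.X W.X ▷ A.X ≫ W.actRight)

theorem comp_ev (V W X : HRep k H) {Z : HRep k H} (q : X ⟶ Z) :
    comp V W X ▷ V ≫ ev V X ≫ q = (α_ _ _ _).hom ≫ ihom W X ◁ ev V W ≫ ev W X ≫ q := by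
  have := ev_curry ((α_ _ _ _).hom ≫ ihom W X ◁ ev V W ≫ ev W X)
  rw [comp, ← Category.assoc, this]
  simp only [Category.assoc]

theorem lhat_ev (V : Bimod A A) {Z : HRep k H} (q : V.X ⟶ Z) :
    lhat V ▷ V.X ≫ ev V.X V.X ≫ q = V.actLeft ≫ q := by
  rw [lhat, ← Category.assoc, ev_curry]

theorem homActLeft_ev (V W : Bimod A A) {Z : HRep k H} (q : W.X ⟶ Z) :
    homActLeft V W ▷ V.X ≫ ev V.X W.X ≫ q =
      (α_ _ _ _).hom ≫ A.X ◁ ev V.X W.X ≫ W.actLeft ≫ q := by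
  rw [homActLeft, comp_whiskerRight, Category.assoc, comp_ev, ← lhat_ev W q]
  rw [associator_naturality_left_assoc, whisker_exchange_assoc]

theorem homActRight_ev (V W : Bimod A A) {Z : HRep k H} (q : W.X ⟶ Z) :
    homActRight V W ▷ V.X ≫ ev V.X W.X ≫ q =
      (α_ _ _ _).hom ≫ ihom V.X W.X ◁ V.actLeft ≫ ev V.X W.X ≫ q := by
  have := lhat_ev V (𝟙 _)
  simp only [Category.comp_id] at this
  rw [homActRight, comp_whiskerRight, Category.assoc, comp_ev, ← this, whiskerLeft_comp,
    associator_naturality_middle_assoc, Category.assoc]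

theorem homActLeft_ev' (V W : Bimod A A) :
    homActLeft V W ▷ V.X ≫ ev V.X W.X = (α_ _ _ _).hom ≫ A.X ◁ ev V.X W.X ≫ W.actLeft := by
  simpa only [Category.comp_id] using homActLeft_ev V W (𝟙 _)

theorem homActRight_ev' (V W : Bimod A A) :
    homActRight V W ▷ V.X ≫ ev V.X W.X =
      (α_ _ _ _).hom ≫ ihom V.X W.X ◁ V.actLeft ≫ ev V.X W.X := by
  simpa only [Category.comp_id] using homActRight_ev V W (𝟙 _)

/-- The `A`-bimodule `hom(V, W)`. -/
noncomputable def homBimod (V W : Bimod A A) : Bimod A A where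
  X := ihom V.X W.X
  actLeft := homActLeft V W
  actRight := homActRight V W
  one_actLeft := by
    refine ihom_ext ?_
    rw [comp_whiskerRight, Category.assoc, homActLeft_ev', associator_naturality_left_assoc,
      ← whisker_exchange_assoc, Bimod.one_actLeft, leftUnitor_naturality, leftUnitor_tensor_hom_assoc,
      Iso.hom_inv_id_assoc]
  left_assoc := by
    refine ihom_ext ?_
    simp only [comp_whiskerRight, Category.assoc]
    rw [homActLeft_ev', associator_naturality_left_assoc,
      ← whisker_exchange_assoc, Bimod.left_assoc, associator_naturality_middle_assoc,
      ← MonoidalCategory.whiskerLeft_comp_assoc, homActLeft_ev']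
    simp
  actRight_one := by
    refine ihom_ext ?_
    rw [comp_whiskerRight, Category.assoc, homActRight_ev', associator_naturality_middle_assoc,
      ← MonoidalCategory.whiskerLeft_comp_assoc, Bimod.one_actLeft, triangle_assoc]
  right_assoc := by
    refine ihom_ext ?_
    simp only [comp_whiskerRight, Category.assoc]
    rw [homActRight_ev', associator_naturality_middle_assoc,
      ← MonoidalCategory.whiskerLeft_comp_assoc, Bimod.left_assoc,
      associator_naturality_left_assoc, ← whisker_exchange_assoc, homActRight_ev']
    simp
  middle_assoc := by
    refine ihom_ext ?_
    simp only [comp_whiskerRight, Category.assoc]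
    rw [homActRight_ev', homActLeft_ev', associator_naturality_left_assoc,
      ← whisker_exchange_assoc, homActLeft_ev', associator_naturality_middle_assoc,
      ← MonoidalCategory.whiskerLeft_comp_assoc, homActRight_ev']
    simp

theorem evR_ev (V W : Bimod A A) {Z : HRep k H} (q : W.X ⟶ Z) :
    evR V W ▷ (V.X ⊗ A.X) ≫ ev (V.X ⊗ A.X) W.X ≫ q =
      ihom V.X W.X ◁ V.actRight ≫ ev V.X W.X ≫ q := by
  rw [evR, ← Category.assoc, ev_curry, Category.assoc]

theorem rEv_ev (V W : Bimod A A) {Z : HRep k H} (q : W.X ⟶ Z) :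
    rEv V W ▷ (V.X ⊗ A.X) ≫ ev (V.X ⊗ A.X) W.X ≫ q =
      (α_ _ _ _).inv ≫ ev V.X W.X ▷ A.X ≫ W.actRight ≫ q := by
  rw [rEv, ← Category.assoc, ev_curry]
  simp only [Category.assoc]

theorem evR_ev' (V W : Bimod A A) :
    evR V W ▷ (V.X ⊗ A.X) ≫ ev (V.X ⊗ A.X) W.X = ihom V.X W.X ◁ V.actRight ≫ ev V.X W.X := by
  simpa only [Category.comp_id] using evR_ev V W (𝟙 _)

theorem rEv_ev' (V W : Bimod A A) :
    rEv V W ▷ (V.X ⊗ A.X) ≫ ev (V.X ⊗ A.X) W.X =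
      (α_ _ _ _).inv ≫ ev V.X W.X ▷ A.X ≫ W.actRight := by
  simpa only [Category.comp_id] using rEv_ev V W (𝟙 _)

/-- A morphism into `hom(V, W)` equalizes `evR` and `rEv` if it does so after evaluation. -/
theorem equalizes_iff (V W : Bimod A A) {Z : HRep k H} (q : Z ⟶ ihom V.X W.X) :
    q ≫ evR V W = q ≫ rEv V W ↔
      Z ◁ V.actRight ≫ q ▷ V.X ≫ ev V.X W.X =
        (α_ _ _ _).inv ≫ (q ▷ V.X ≫ ev V.X W.X) ▷ A.X ≫ W.actRight := by
  have h1 : (q ≫ evR V W) ▷ (V.X ⊗ A.X) ≫ ev (V.X ⊗ A.X) W.X =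
      Z ◁ V.actRight ≫ q ▷ V.X ≫ ev V.X W.X := by
    rw [comp_whiskerRight, Category.assoc, evR_ev', ← whisker_exchange_assoc]
  have h2 : (q ≫ rEv V W) ▷ (V.X ⊗ A.X) ≫ ev (V.X ⊗ A.X) W.X =
      (α_ _ _ _).inv ≫ (q ▷ V.X ≫ ev V.X W.X) ▷ A.X ≫ W.actRight := by
    rw [comp_whiskerRight, Category.assoc, rEv_ev', associator_inv_naturality_left_assoc,
      comp_whiskerRight, Category.assoc]
  rw [← h1, ← h2]
  exact ⟨fun h => by rw [h], ihom_ext⟩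

/-- The inclusion of `hom_A(V, W)`, the kernel of `evR - rEv`, into `hom(V, W)`. -/
noncomputable abbrev incl (V W : Bimod A A) : ker (evR V W) (rEv V W) ⟶ ihom V.X W.X :=
  kerι (evR V W) (rEv V W)

theorem incl_eq (V W : Bimod A A) :
    ker (evR V W) (rEv V W) ◁ V.actRight ≫ incl V W ▷ V.X ≫ ev V.X W.X =
      (α_ _ _ _).inv ≫ (incl V W ▷ V.X ≫ ev V.X W.X) ▷ A.X ≫ W.actRight :=
  (equalizes_iff V W (incl V W)).1 (kerι_comp _ _)

theorem actLeft_equalizes (V W : Bimod A A) :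
    (A.X ◁ incl V W ≫ homActLeft V W) ≫ evR V W =
      (A.X ◁ incl V W ≫ homActLeft V W) ≫ rEv V W := by
  have h : (A.X ◁ incl V W ≫ homActLeft V W) ▷ V.X ≫ ev V.X W.X =
      (α_ _ _ _).hom ≫ A.X ◁ (incl V W ▷ V.X ≫ ev V.X W.X) ≫ W.actLeft := by
    rw [comp_whiskerRight, Category.assoc, homActLeft_ev', associator_naturality_middle_assoc,
      MonoidalCategory.whiskerLeft_comp_assoc]
  rw [equalizes_iff, h, associator_naturality_right_assoc,
    ← MonoidalCategory.whiskerLeft_comp_assoc, incl_eq]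
  simp

theorem actRight_equalizes (V W : Bimod A A) :
    (incl V W ▷ A.X ≫ homActRight V W) ≫ evR V W =
      (incl V W ▷ A.X ≫ homActRight V W) ≫ rEv V W := by
  have h : (incl V W ▷ A.X ≫ homActRight V W) ▷ V.X ≫ ev V.X W.X =
      (α_ _ _ _).hom ≫ ker (evR V W) (rEv V W) ◁ V.actLeft ≫ incl V W ▷ V.X ≫ ev V.X W.X := by
    rw [comp_whiskerRight, Category.assoc, homActRight_ev', associator_naturality_left_assoc,
      whisker_exchange_assoc]
  rw [equalizes_iff, h]
  have h2 : (α_ _ _ _).inv ≫ V.actLeft ▷ A.X ≫ V.actRight = A.X ◁ V.actRight ≫ V.actLeft := by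
    rw [Bimod.middle_assoc, Iso.inv_hom_id_assoc]
  rw [associator_naturality_right_assoc, ← MonoidalCategory.whiskerLeft_comp_assoc, ← h2]
  simp only [comp_whiskerRight, Category.assoc, MonoidalCategory.whiskerLeft_comp]
  have h3 := incl_eq V W
  simp only [comp_whiskerRight, Category.assoc] at h3
  rw [h3]
  simp

/-- The `A`-bimodule `hom_A(V, W)`, with the actions restricted from `hom(V, W)`. -/
noncomputable def homABimod (V W : Bimod A A) : Bimod A A where
  X := ker (evR V W) (rEv V W)
  actLeft := kerLift (A.X ◁ incl V W ≫ homActLeft V W) (actLeft_equalizes V W)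
  actRight := kerLift (incl V W ▷ A.X ≫ homActRight V W) (actRight_equalizes V W)
  one_actLeft := by
    rw [← cancel_mono (incl V W), Category.assoc, kerLift_ι, ← whisker_exchange_assoc,
      ← leftUnitor_naturality]
    exact congrArg _ (homBimod V W).one_actLeft
  left_assoc := by
    rw [← cancel_mono (incl V W)]
    simp only [Category.assoc, kerLift_ι]
    rw [← whisker_exchange_assoc, ← MonoidalCategory.whiskerLeft_comp_assoc, kerLift_ι]
    have := (homBimod V W).left_assoc
    refine (congrArg _ this).trans ?_
    simp [homBimod]
  actRight_one := by
    rw [← cancel_mono (incl V W), Category.assoc, kerLift_ι, whisker_exchange_assoc,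
      ← rightUnitor_naturality]
    exact congrArg _ (homBimod V W).actRight_one
  right_assoc := by
    rw [← cancel_mono (incl V W)]
    simp only [Category.assoc, kerLift_ι]
    rw [whisker_exchange_assoc, ← comp_whiskerRight_assoc, kerLift_ι]
    have := (homBimod V W).right_assoc
    refine (congrArg _ this).trans ?_
    simp [homBimod]
  middle_assoc := by
    rw [← cancel_mono (incl V W)]
    simp only [Category.assoc, kerLift_ι]
    rw [← comp_whiskerRight_assoc, kerLift_ι, ← MonoidalCategory.whiskerLeft_comp_assoc,
      kerLift_ι]
    have := (homBimod V W).middle_assoc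
    simp only [comp_whiskerRight_assoc]
    refine (congrArg _ this).trans ?_
    simp [homBimod]

theorem ihomMap_equalizes {V V' W W' : Bimod A A} (f : V' ⟶ V) (g : W ⟶ W') :
    (incl V W ≫ ihomMap f.hom g.hom) ≫ evR V' W' =
      (incl V W ≫ ihomMap f.hom g.hom) ≫ rEv V' W' := by
  have h : (incl V W ≫ ihomMap f.hom g.hom) ▷ V'.X ≫ ev V'.X W'.X =
      ker (evR V W) (rEv V W) ◁ f.hom ≫ incl V W ▷ V.X ≫ ev V.X W.X ≫ g.hom := by
    rw [comp_whiskerRight, Category.assoc, ihomMap_ev, whisker_exchange_assoc]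
  have h3 := incl_eq V W
  simp only [comp_whiskerRight, Category.assoc] at h3
  rw [equalizes_iff, h, ← MonoidalCategory.whiskerLeft_comp_assoc, f.right_act_hom]
  simp only [comp_whiskerRight, Category.assoc, MonoidalCategory.whiskerLeft_comp]
  rw [reassoc_of% h3, ← g.right_act_hom]
  simp

theorem homActLeft_map {V V' W W' : Bimod A A} (f : V' ⟶ V) (g : W ⟶ W') :
    homActLeft V W ≫ ihomMap f.hom g.hom = A.X ◁ ihomMap f.hom g.hom ≫ homActLeft V' W' := by
  refine ihom_ext ?_
  simp only [comp_whiskerRight, Category.assoc]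
  rw [ihomMap_ev, ← whisker_exchange_assoc, homActLeft_ev, homActLeft_ev', g.left_act_hom,
    associator_naturality_middle_assoc,
    ← MonoidalCategory.whiskerLeft_comp_assoc A.X (ihomMap f.hom g.hom ▷ V'.X), ihomMap_ev]
  simp

theorem homActRight_map {V V' W W' : Bimod A A} (f : V' ⟶ V) (g : W ⟶ W') :
    homActRight V W ≫ ihomMap f.hom g.hom = ihomMap f.hom g.hom ▷ A.X ≫ homActRight V' W' := by
  refine ihom_ext ?_
  simp only [comp_whiskerRight, Category.assoc]
  rw [ihomMap_ev, ← whisker_exchange_assoc, homActRight_ev, homActRight_ev',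
    associator_naturality_left_assoc, ← whisker_exchange_assoc, ihomMap_ev,
    associator_naturality_right_assoc, ← MonoidalCategory.whiskerLeft_comp_assoc,
    ← MonoidalCategory.whiskerLeft_comp_assoc, f.left_act_hom]

theorem homAMap_left {V V' W W' : Bimod A A} (f : V' ⟶ V) (g : W ⟶ W') :
    kerLift (A.X ◁ incl V W ≫ homActLeft V W) (actLeft_equalizes V W) ≫
        kerLift (incl V W ≫ ihomMap f.hom g.hom) (ihomMap_equalizes f g) =
      A.X ◁ kerLift (incl V W ≫ ihomMap f.hom g.hom) (ihomMap_equalizes f g) ≫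
        kerLift (A.X ◁ incl V' W' ≫ homActLeft V' W') (actLeft_equalizes V' W') := by
  rw [← cancel_mono (incl V' W')]
  simp only [Category.assoc, kerLift_ι]
  rw [← MonoidalCategory.whiskerLeft_comp_assoc, kerLift_ι, ← Category.assoc, kerLift_ι,
    Category.assoc, homActLeft_map, MonoidalCategory.whiskerLeft_comp_assoc]

theorem homAMap_right {V V' W W' : Bimod A A} (f : V' ⟶ V) (g : W ⟶ W') :
    kerLift (incl V W ▷ A.X ≫ homActRight V W) (actRight_equalizes V W) ≫
        kerLift (incl V W ≫ ihomMap f.hom g.hom) (ihomMap_equalizes f g) =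
      kerLift (incl V W ≫ ihomMap f.hom g.hom) (ihomMap_equalizes f g) ▷ A.X ≫
        kerLift (incl V' W' ▷ A.X ≫ homActRight V' W') (actRight_equalizes V' W') := by
  rw [← cancel_mono (incl V' W')]
  simp only [Category.assoc, kerLift_ι]
  rw [← comp_whiskerRight_assoc, kerLift_ι, ← Category.assoc, kerLift_ι,
    Category.assoc, homActRight_map, comp_whiskerRight_assoc]

/-- `L ↦ g ∘ L ∘ f` on `hom_A`. -/
noncomputable def homAMap {V V' W W' : Bimod A A} (f : V' ⟶ V) (g : W ⟶ W') :
    homABimod V W ⟶ homABimod V' W' where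
  hom := kerLift (incl V W ≫ ihomMap f.hom g.hom) (ihomMap_equalizes f g)
  left_act_hom := homAMap_left f g
  right_act_hom := homAMap_right f g

/-- The internal hom functor of the category of `A`-bimodules. -/
noncomputable def homA (A : Mon (HRep k H)) : (Bimod A A)ᵒᵖ ⥤ Bimod A A ⥤ Bimod A A where
  obj V :=
    { obj := fun W => homABimod V.unop W
      map := fun g => homAMap (𝟙 _) g
      map_id := fun _ => rfl
      map_comp := fun _ _ => rfl }
  map f :=
    { app := fun W => homAMap f.unop (𝟙 W)
      naturality := fun _ _ _ => rfl }
  map_id _ := rfl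
  map_comp _ _ := rfl

/-- The projection `V ⊗ W → V ⊗_A W`. -/
noncomputable def proj (V W : Bimod A A) : V.X ⊗ W.X ⟶ (V ⊗ W).X :=
  Limits.coequalizer.π (V.actRight ▷ W.X) ((α_ V.X A.X W.X).hom ≫ V.X ◁ W.actLeft)

/-- The element `v ⊗_A w` of `V ⊗_A W`. -/
noncomputable def tmulA {V W : Bimod A A} (v : V.X) (w : W.X) : (V ⊗ W).X :=
  (proj V W).toLin (v ⊗ₜ[k] w)

/-- The `A`-bimodule morphism `hom_A(V, W) → hom(V, W)`. -/
noncomputable def inclBimod (V W : Bimod A A) : homABimod V W ⟶ homBimod V W where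
  hom := incl V W
  left_act_hom := kerLift_ι _ (actLeft_equalizes V W)
  right_act_hom := kerLift_ι _ (actRight_equalizes V W)

/-- An element of `hom_A(V, W)` as a linear map. -/
noncomputable def mapA {V W : Bimod A A} (L : (homABimod V W).X) : V.X →ₗ[k] W.X :=
  (inclBimod V W).hom.toLin L

end HomA

end HRep

/-! The category of `H`-modules is already closed: `ev_curry` and `curry_ev` say that currying and
evaluation are mutually inverse, so an equivariant map f : V ⊗ W → X is the same thing as an
equivariant map q : V → hom(W, X). Both identities rest on the pentagon. Contracting adjacent legs
with α or β turns the coproducts in it into counits, two of the factors then disappear because φ and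
its inverse are trivial under the counit, and the remaining factor contracts to 1 by the axioms
linking φ, α, β and `S` (`Q_main`, `R_main`).

What remains is formal. Under the correspondence f ↔ q three conditions match: (i) f is balanced
over `A` exactly when q is right `A`-linear, because by `homActRight_ev'` the right action on hom(W,
X) evaluates to the left action on W applied to the argument; (ii) f is linear for the left action
on V exactly when q is left `A`-linear, because by `homActLeft_ev'` the left action on hom(W, X)
evaluates to the left action on X applied to the value; (iii) f is linear for the right action on W
exactly when q equalizes `evR` and `rEv`, which is `equalizes_iff`.

A bimodule morphism V ⊗_A W → X is an f with all three properties: the projection from V ⊗ W is a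
coequalizer, and it stays epi after tensoring with `A`, so linearity may be tested on V ⊗ W. A
bimodule morphism V → hom_A(W, X) is a q with all three properties: hom_A(W, X) is an equalizer with
restricted actions, and its inclusion is mono. So both sides are the same data, and naturality is
inherited from `curry`. The weak linearity criterion is (iii) for an arbitrary source Z, written on
elements. -/

namespace HRep

/-! ### Naturality of currying, and formulas in the legs of φ -/

section CurryNat

variable {k H : Type u} [CommRing k] [Ring H] [Algebra k H] [QuasiHopfAlgebra k H]

/-- A morphism into an internal hom is determined by its evaluation (`ihom_ext`), and both sides
evaluate to the same map by `ev_curry`. -/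
theorem curry_comp_left {V V' W X : HRep k H} (p : V ⟶ V') (f : V' ⊗ W ⟶ X) :
    curry (p ▷ W ≫ f) = p ≫ curry f :=
  ihom_ext (by rw [ev_curry, comp_whiskerRight, Category.assoc, ev_curry])

/-- Again the two sides are compared after evaluation, where `ihomMap_ev` turns `ihomMap p q` into p
on the argument and q on the value. -/
theorem curry_comp_map {V W W' X X' : HRep k H} (p : W' ⟶ W) (f : V ⊗ W ⟶ X) (q : X ⟶ X') :
    curry (V ◁ p ≫ f ≫ q) = curry f ≫ ihomMap p q :=
  ihom_ext (by
    rw [ev_curry, comp_whiskerRight, Category.assoc, ihomMap_ev, ← whisker_exchange_assoc,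
      reassoc_of% (ev_curry f)])

/-- The inverse of φ enters `curryLin` linearly, through `Kmap`, so any decomposition into pure
tensors may be substituted. This gives a meaning to the summation over legs. -/
theorem curryLin_eq_sum {V W X : HRep k H} (f : V ⊗[k] W →ₗ[k] X) {n : ℕ} {x y z : Fin n → H}
    (h : (QuasiHopfAlgebra.φ : (H ⊗[k] (H ⊗[k] H))ˣ)⁻¹.val = ∑ i, x i ⊗ₜ[k] (y i ⊗ₜ[k] z i))
    (v : V) (w : W) :
    curryLin f v w = ∑ i, f (V.ρ (x i) v ⊗ₜ[k]
      W.ρ (y i * QuasiHopfAlgebra.β k * QuasiHopfAlgebra.S (k := k) (z i)) w) := by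
  rw [curryLin_apply, h]
  simp only [map_sum, LinearMap.sum_apply, Kmap_tmul, actT_tmul]

theorem evLin_eq_sum (V W : HRep k H) {n : ℕ} {x y z : Fin n → H}
    (h : (QuasiHopfAlgebra.φ : (H ⊗[k] (H ⊗[k] H))ˣ).val = ∑ i, x i ⊗ₜ[k] (y i ⊗ₜ[k] z i))
    (L : V →ₗ[k] W) (v : V) :
    evLin V W (L ⊗ₜ v) = ∑ i, W.ρ (x i) (L
      (V.ρ (QuasiHopfAlgebra.S (k := k) (y i) * QuasiHopfAlgebra.α k * z i) v)) := by
  rw [evLin_tmul, h]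
  simp only [map_sum, LinearMap.sum_apply, Lmap_tmul, sand_tmul]

theorem assoc_inv_eq_sum (V W X : HRep k H) {n : ℕ} {x y z : Fin n → H}
    (h : (QuasiHopfAlgebra.φ : (H ⊗[k] (H ⊗[k] H))ˣ)⁻¹.val = ∑ i, x i ⊗ₜ[k] (y i ⊗ₜ[k] z i))
    (v : V) (w : W) (u : X) :
    (α_ V W X).inv.toLin (v ⊗ₜ[k] (w ⊗ₜ[k] u)) =
      ∑ i, (V.ρ (x i) v ⊗ₜ[k] W.ρ (y i) w) ⊗ₜ[k] X.ρ (z i) u := by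
  -- The associator rebrackets and then acts by φ; its inverse therefore acts by the inverse of φ
  -- first and rebrackets afterwards.
  change (TensorProduct.assoc k V W X).symm (act3 V W X
    (QuasiHopfAlgebra.φ : (H ⊗[k] (H ⊗[k] H))ˣ)⁻¹.val (v ⊗ₜ[k] (w ⊗ₜ[k] u))) = _
  rw [h]
  simp only [map_sum, LinearMap.sum_apply, actT_tmul, TensorProduct.assoc_symm_tmul]

end CurryNat

/-! ### The tensor product over `A` as a coequalizer -/

section Proj

variable {k H : Type u} [CommRing k] [Ring H] [Algebra k H] [QuasiHopfAlgebra k H]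
  {A : Mon (HRep k H)}

instance (V W : Bimod A A) : Epi (proj V W) :=
  inferInstanceAs (Epi (Limits.coequalizer.π _ _))

/-- Tensoring with a fixed `H`-module preserves colimits, hence epimorphisms. This instance and the
next allow linearity of a map out of V ⊗_A W to be tested on V ⊗ W. -/
instance (V W : Bimod A A) : Epi (A.X ◁ proj V W) :=
  inferInstanceAs (Epi ((tensorLeft A.X).map (Limits.coequalizer.π
    (V.actRight ▷ W.X) ((α_ V.X A.X W.X).hom ≫ V.X ◁ W.actLeft))))

instance (V W : Bimod A A) : Epi (proj V W ▷ A.X) :=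
  inferInstanceAs (Epi ((tensorRight A.X).map (Limits.coequalizer.π
    (V.actRight ▷ W.X) ((α_ V.X A.X W.X).hom ≫ V.X ◁ W.actLeft))))

theorem proj_condition (V W : Bimod A A) :
    V.actRight ▷ W.X ≫ proj V W = (α_ V.X A.X W.X).hom ≫ V.X ◁ W.actLeft ≫ proj V W :=
  (Limits.coequalizer.condition (V.actRight ▷ W.X)
    ((α_ V.X A.X W.X).hom ≫ V.X ◁ W.actLeft)).trans (Category.assoc _ _ _)

/-- `A` acts on V ⊗_A W through the outer factors: on the left through V, and, in the next lemma, on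
the right through W. -/
theorem proj_actLeft (V W : Bimod A A) :
    A.X ◁ proj V W ≫ (V ⊗ W).actLeft = (α_ _ _ _).inv ≫ V.actLeft ▷ W.X ≫ proj V W :=
  Bimod.TensorBimod.whiskerLeft_π_actLeft V W

theorem proj_actRight (V W : Bimod A A) :
    proj V W ▷ A.X ≫ (V ⊗ W).actRight = (α_ _ _ _).hom ≫ V.X ◁ W.actRight ≫ proj V W :=
  Bimod.TensorBimod.π_tensor_id_actRight V W

theorem proj_whiskerLeft (V : Bimod A A) {W W' : Bimod A A} (f : W ⟶ W') :
    proj V W ≫ (V ◁ f).hom = V.X ◁ f.hom ≫ proj V W' :=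
  Limits.ι_colimMap _ _

theorem proj_whiskerRight {V V' : Bimod A A} (f : V ⟶ V') (W : Bimod A A) :
    proj V W ≫ (f ▷ W).hom = f.hom ▷ W.X ≫ proj V' W :=
  Limits.ι_colimMap _ _

theorem tensorBimod_hom_ext {V W X : Bimod A A} {f g : V ⊗ W ⟶ X}
    (h : proj V W ≫ f.hom = proj V W ≫ g.hom) : f = g :=
  Bimod.hom_ext _ _ ((cancel_epi (proj V W)).1 h)

/-- The morphism out of `V ⊗_A W` induced by an `A`-balanced morphism out of `V ⊗ W`. -/
noncomputable def projDesc {V W : Bimod A A} {X : HRep k H} (f : V.X ⊗ W.X ⟶ X)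
    (hf : V.actRight ▷ W.X ≫ f = (α_ V.X A.X W.X).hom ≫ V.X ◁ W.actLeft ≫ f) :
    (V ⊗ W).X ⟶ X :=
  Limits.coequalizer.desc f (hf.trans (Category.assoc _ _ _).symm)

theorem proj_projDesc {V W : Bimod A A} {X : HRep k H} (f : V.X ⊗ W.X ⟶ X)
    (hf : V.actRight ▷ W.X ≫ f = (α_ V.X A.X W.X).hom ≫ V.X ◁ W.actLeft ≫ f) :
    proj V W ≫ projDesc f hf = f :=
  Limits.coequalizer.π_desc _ _

end Proj

/-! ### Currying over `A` -/

section Adjunction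

variable {k H : Type u} [CommRing k] [Ring H] [Algebra k H] [QuasiHopfAlgebra k H]
  {A : Mon (HRep k H)} {V W X : Bimod A A}

/-- Only the right linearity of f matters: `A` acts on the right of V ⊗_A W through W, so on V ⊗ W
this linearity is the evaluated condition of `equalizes_iff`. -/
theorem curry_proj_equalizes (f : V ⊗ W ⟶ X) :
    curry (proj V W ≫ f.hom) ≫ evR W X = curry (proj V W ≫ f.hom) ≫ rEv W X := by
  rw [equalizes_iff, ev_curry, comp_whiskerRight_assoc, ← f.right_act_hom,
    reassoc_of% (proj_actRight V W), Iso.inv_hom_id_assoc]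

/-- After evaluation this is the left linearity of f, transported to V ⊗ W by `proj_actLeft`. -/
theorem curry_proj_actLeft (f : V ⊗ W ⟶ X) :
    V.actLeft ≫ curry (proj V W ≫ f.hom) =
      A.X ◁ curry (proj V W ≫ f.hom) ≫ homActLeft W X := by
  refine ihom_ext ?_
  rw [comp_whiskerRight_assoc, ev_curry, comp_whiskerRight_assoc, homActLeft_ev',
    associator_naturality_middle_assoc, ← MonoidalCategory.whiskerLeft_comp_assoc, ev_curry,
    MonoidalCategory.whiskerLeft_comp_assoc, ← f.left_act_hom, reassoc_of% (proj_actLeft V W),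
    Iso.hom_inv_id_assoc]

/-- After evaluation this is the coequalizer relation of V ⊗_A W; no linearity of f is involved. -/
theorem curry_proj_actRight (f : V ⊗ W ⟶ X) :
    V.actRight ≫ curry (proj V W ≫ f.hom) =
      curry (proj V W ≫ f.hom) ▷ A.X ≫ homActRight W X := by
  refine ihom_ext ?_
  rw [comp_whiskerRight_assoc, ev_curry, comp_whiskerRight_assoc, homActRight_ev',
    associator_naturality_left_assoc, ← whisker_exchange_assoc, ev_curry,
    reassoc_of% (proj_condition V W)]

variable (W X) in
/-- The inclusion of `hom_A(W, X)` into `hom(W, X)`. -/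
noncomputable def inclA : (homABimod W X).X ⟶ ihom W.X X.X := incl W X

/-- `inclA` is `incl` with its source read as the underlying object of `homABimod W X`, the form in
which underlying maps of bimodule morphisms meet it. -/
instance : Mono (inclA W X) := inferInstanceAs (Mono (kerι (evR W X) (rEv W X)))

theorem inclA_equalizes : inclA W X ≫ evR W X = inclA W X ≫ rEv W X := kerι_comp _ _

/-- A morphism that equalizes `evR` and `rEv` factors through `hom_A(W, X)`. -/
noncomputable def liftA {Z : HRep k H} (q : Z ⟶ ihom W.X X.X) (hq : q ≫ evR W X = q ≫ rEv W X) :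
    Z ⟶ (homABimod W X).X :=
  kerLift q hq

theorem liftA_inclA {Z : HRep k H} (q : Z ⟶ ihom W.X X.X) (hq : q ≫ evR W X = q ≫ rEv W X) :
    liftA q hq ≫ inclA W X = q :=
  rfl

theorem actLeft_inclA : (homABimod W X).actLeft ≫ inclA W X = A.X ◁ inclA W X ≫ homActLeft W X :=
  (inclBimod W X).left_act_hom

theorem actRight_inclA :
    (homABimod W X).actRight ≫ inclA W X = inclA W X ▷ A.X ≫ homActRight W X :=
  (inclBimod W X).right_act_hom

/-- The currying of a morphism `V ⊗_A W → X` of bimodules. -/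
noncomputable def curryA (f : V ⊗ W ⟶ X) : V ⟶ homABimod W X where
  hom := liftA (curry (proj V W ≫ f.hom)) (curry_proj_equalizes f)
  left_act_hom := by
    rw [← cancel_mono (inclA W X), Category.assoc, Category.assoc, actLeft_inclA,
      ← MonoidalCategory.whiskerLeft_comp_assoc, liftA_inclA, curry_proj_actLeft]
  right_act_hom := by
    rw [← cancel_mono (inclA W X), Category.assoc, Category.assoc, actRight_inclA,
      ← comp_whiskerRight_assoc, liftA_inclA, curry_proj_actRight]

theorem curryA_hom_inclA (f : V ⊗ W ⟶ X) :
    (curryA f).hom ≫ inclA W X = curry (proj V W ≫ f.hom) := rfl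

/-! ### Uncurrying over `A` -/

/-- The morphism `v ⊗ w ↦ ev(g(v) ⊗ w)`. -/
noncomputable def evalA (g : V ⟶ homABimod W X) : V.X ⊗ W.X ⟶ X.X :=
  (g.hom ≫ inclA W X) ▷ W.X ≫ ev W.X X.X

/-- Composing g with the bimodule inclusion gives a bimodule morphism into the full hom(W, X), whose
actions have known evaluations. -/
theorem actLeft_hom_inclA (g : V ⟶ homABimod W X) :
    V.actLeft ≫ g.hom ≫ inclA W X = A.X ◁ (g.hom ≫ inclA W X) ≫ homActLeft W X :=
  (g ≫ inclBimod W X).left_act_hom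

theorem actRight_hom_inclA (g : V ⟶ homABimod W X) :
    V.actRight ≫ g.hom ≫ inclA W X = (g.hom ≫ inclA W X) ▷ A.X ≫ homActRight W X :=
  (g ≫ inclBimod W X).right_act_hom

/-- The right linearity of g, evaluated: acting by a on the right of g(v) amounts, up to the
associator, to acting by a on the left of w. -/
theorem evalA_balanced (g : V ⟶ homABimod W X) :
    V.actRight ▷ W.X ≫ evalA g = (α_ V.X A.X W.X).hom ≫ V.X ◁ W.actLeft ≫ evalA g := by
  rw [evalA, ← comp_whiskerRight_assoc, actRight_hom_inclA, comp_whiskerRight_assoc,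
    homActRight_ev', associator_naturality_left_assoc, whisker_exchange_assoc]

theorem evalA_actLeft (g : V ⟶ homABimod W X) :
    V.actLeft ▷ W.X ≫ evalA g = (α_ A.X V.X W.X).hom ≫ A.X ◁ evalA g ≫ X.actLeft := by
  rw [evalA, ← comp_whiskerRight_assoc, actLeft_hom_inclA, comp_whiskerRight_assoc,
    homActLeft_ev', associator_naturality_middle_assoc,
    ← MonoidalCategory.whiskerLeft_comp_assoc]

/-- Here only the fact that g takes values in hom_A(W, X) is used, not its linearity. -/
theorem evalA_actRight (g : V ⟶ homABimod W X) :
    V.X ◁ W.actRight ≫ evalA g = (α_ V.X W.X A.X).inv ≫ evalA g ▷ A.X ≫ X.actRight :=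
  (equalizes_iff W X (g.hom ≫ inclA W X)).1
    (by rw [Category.assoc, inclA_equalizes, Category.assoc])

/-- The uncurrying of a morphism `V → hom_A(W, X)` of bimodules. -/
noncomputable def uncurryA (g : V ⟶ homABimod W X) : V ⊗ W ⟶ X where
  hom := projDesc (evalA g) (evalA_balanced g)
  left_act_hom := by
    -- Precomposing with an epimorphism reduces the claim to `evalA_actLeft` on A ⊗ (V ⊗ W); the
    -- right action is treated in the same way.
    rw [← cancel_epi (A.X ◁ proj V W), reassoc_of% (proj_actLeft V W), proj_projDesc, evalA_actLeft,
      Iso.inv_hom_id_assoc, ← MonoidalCategory.whiskerLeft_comp_assoc, proj_projDesc]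
  right_act_hom := by
    rw [← cancel_epi (proj V W ▷ A.X), reassoc_of% (proj_actRight V W), proj_projDesc,
      evalA_actRight, Iso.hom_inv_id_assoc, ← comp_whiskerRight_assoc, proj_projDesc]

theorem proj_uncurryA (g : V ⟶ homABimod W X) : proj V W ≫ (uncurryA g).hom = evalA g :=
  proj_projDesc _ (evalA_balanced g)

theorem homABimod_hom_ext {f g : V ⟶ homABimod W X}
    (h : f.hom ≫ inclA W X = g.hom ≫ inclA W X) : f = g :=
  Bimod.hom_ext _ _ ((cancel_mono (inclA W X)).1 h)

/-! ### The bijection, its naturality, and the parametrized adjunction -/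

variable (V W X) in
/-- Bimodule morphisms `V ⊗_A W → X` correspond to bimodule morphisms `V → hom_A(W, X)`. -/
noncomputable def curryAEquiv : (V ⊗ W ⟶ X) ≃ (V ⟶ homABimod W X) where
  toFun := curryA
  invFun := uncurryA
  -- Testing after the epi `proj` here, and after the mono `inclA` below, leaves the two identities
  -- `ev_curry` and `curry_ev` for `H`-modules.
  left_inv f := tensorBimod_hom_ext (by
    rw [proj_uncurryA, evalA, curryA_hom_inclA, ev_curry])
  right_inv g := homABimod_hom_ext (by
    rw [curryA_hom_inclA, proj_uncurryA, evalA, curry_ev])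

theorem homAMap_hom_inclA {V V' W W' : Bimod A A} (f : V' ⟶ V) (g : W ⟶ W') :
    (homAMap f g).hom ≫ inclA V' W' = inclA V W ≫ ihomMap f.hom g.hom := rfl

theorem curryA_whiskerRight {V' : Bimod A A} (p : V' ⟶ V) (f : V ⊗ W ⟶ X) :
    curryA (p ▷ W ≫ f) = p ≫ curryA f :=
  homABimod_hom_ext (by
    rw [curryA_hom_inclA, Bimod.comp_hom', Bimod.comp_hom', reassoc_of% (proj_whiskerRight p W),
      curry_comp_left, Category.assoc, curryA_hom_inclA])

/-- Naturality in W and X at once, inherited from `curry_comp_map` through `inclA`. Taking p or q to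
be an identity gives the two separate naturalities needed below. -/
theorem curryA_comp_homAMap {W' X' : Bimod A A} (p : W' ⟶ W) (f : V ⊗ W ⟶ X) (q : X ⟶ X') :
    curryA (V ◁ p ≫ f ≫ q) = curryA f ≫ homAMap p q :=
  homABimod_hom_ext (by
    have := curry_comp_map p.hom (proj V W ≫ f.hom) q.hom
    rw [curryA_hom_inclA, Bimod.comp_hom', Bimod.comp_hom', Bimod.comp_hom', Category.assoc,
      homAMap_hom_inclA, ← Category.assoc (curryA f).hom, curryA_hom_inclA, ← this,
      reassoc_of% (proj_whiskerLeft V p), Category.assoc])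

/-- The adjunction between `- ⊗_A W` and `hom_A(W, -)`. -/
noncomputable def tensorHomAAdj (W : Bimod A A) :
    (curriedTensor (Bimod A A)).flip.obj W ⊣ (homA A).obj (op W) :=
  Adjunction.mkOfHomEquiv
    { homEquiv := fun V X => curryAEquiv V W X
      homEquiv_naturality_left_symm := fun {V' V X} p g => by
        -- Applying the bijection turns the naturality of the inverse into that of `curryA` in V.
        refine (Equiv.symm_apply_eq (curryAEquiv V' W X)).2 ?_
        refine Eq.trans ?_ (curryA_whiskerRight p ((curryAEquiv V W X).symm g)).symm
        exact congrArg _ ((curryAEquiv V W X).apply_symm_apply g).symm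
      homEquiv_naturality_right := fun {V X X'} f q => by
        refine Eq.trans ?_ (curryA_comp_homAMap (𝟙 W) f q)
        refine congrArg (curryA (V := V) (W := W)) ?_
        rw [MonoidalCategory.whiskerLeft_id, Category.id_comp] }

theorem tensorHomAAdj_homEquiv (V W X : Bimod A A) :
    (tensorHomAAdj W).homEquiv V X = curryAEquiv V W X := by
  rw [tensorHomAAdj, Adjunction.mkOfHomEquiv_homEquiv]

variable (A) in
/-- The internal hom functor `hom_A` is right adjoint to the tensor product over `A`, naturally in
the parameter. -/
noncomputable def tensorHomAAdj₂ : (curriedTensor (Bimod A A)).flip ⊣₂ homA A :=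
  ParametrizedAdjunction.mk' tensorHomAAdj fun {W W'} p {V X} f => by
    rw [tensorHomAAdj_homEquiv, tensorHomAAdj_homEquiv]
    -- Compatibility with a change of the parameter W is the case q = 𝟙 of the joint naturality.
    refine Eq.trans ?_ (curryA_comp_homAMap p f (𝟙 X))
    rw [Category.comp_id]
    rfl

/-- The explicit formulas can thus be checked on `curryA` and `uncurryA`. The parameter is the
second tensor factor W, hence the flipped tensor functor. -/
theorem tensorHomAAdj₂_homEquiv (V W X : Bimod A A) :
    (tensorHomAAdj₂ A).homEquiv (X₁ := W) (X₂ := V) (X₃ := X) = curryAEquiv V W X :=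
  tensorHomAAdj_homEquiv V W X

/-! ### The weak right linearity condition -/

theorem exists_lift_iff (V W : Bimod A A) {Z : HRep k H} (q : Z ⟶ ihom V.X W.X) :
    (∃ p : Z ⟶ (homABimod V W).X, p ≫ (inclBimod V W).hom = q) ↔
      q ≫ evR V W = q ≫ rEv V W := by
  constructor
  · rintro ⟨p, rfl⟩
    exact (Category.assoc _ _ _).trans
      ((congrArg (p ≫ ·) (kerι_comp _ _)).trans (Category.assoc _ _ _).symm)
  · exact fun h => ⟨kerLift q h, kerLift_ι q h⟩

/-- This is `equalizes_iff` on pure tensors; the inverse associator there supplies the legs of the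
inverse of φ. -/
theorem equalizes_iff_sum (V W : Bimod A A) {Z : HRep k H} (q : Z ⟶ ihom V.X W.X) {n : ℕ}
    {x y z : Fin n → H}
    (h : (QuasiHopfAlgebra.φ : (H ⊗[k] (H ⊗[k] H))ˣ)⁻¹.val = ∑ i, x i ⊗ₜ[k] (y i ⊗ₜ[k] z i)) :
    q ≫ evR V W = q ≫ rEv V W ↔ ∀ (L : Z) (v : V.X) (a : A.X),
      (ev V.X W.X).toLin (q.toLin L ⊗ₜ[k] V.actRight.toLin (v ⊗ₜ[k] a)) =
        ∑ i, W.actRight.toLin ((ev V.X W.X).toLin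
          ((ihom V.X W.X).ρ (x i) (q.toLin L) ⊗ₜ[k] V.X.ρ (y i) v) ⊗ₜ[k] A.X.ρ (z i) a) := by
  have hr (L : Z) (v : V.X) (a : A.X) :
      Hom.toLin ((α_ Z V.X A.X).inv ≫ (q ▷ V.X ≫ ev V.X W.X) ▷ A.X ≫ W.actRight)
        (L ⊗ₜ[k] (v ⊗ₜ[k] a)) =
      ∑ i, W.actRight.toLin ((ev V.X W.X).toLin
          ((ihom V.X W.X).ρ (x i) (q.toLin L) ⊗ₜ[k] V.X.ρ (y i) v) ⊗ₜ[k] A.X.ρ (z i) a) := by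
    refine (congrArg (Hom.toLin ((q ▷ V.X ≫ ev V.X W.X) ▷ A.X ≫ W.actRight))
      (assoc_inv_eq_sum Z V.X A.X h L v a)).trans ?_
    refine (map_sum (Hom.toLin ((q ▷ V.X ≫ ev V.X W.X) ▷ A.X ≫ W.actRight)) _ _).trans ?_
    refine Finset.sum_congr rfl fun i _ => ?_
    -- The inverse associator acts on Z; equivariance of q moves that action to hom(V, W).
    rw [← q.comm]
    rfl
  rw [equalizes_iff]
  constructor
  · intro e L v a
    rw [← hr, ← e]
    rfl
  · intro e
    refine hom_ext_lin (TensorProduct.ext (LinearMap.ext fun L => TensorProduct.ext'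
      fun v a => ?_))
    exact (e L v a).trans (hr L v a).symm

/-- The criterion in the theorem ranges over all decompositions of the inverse of φ. At least one
must exist, or the condition would be vacuous. -/
theorem exists_eq_sum_tmul_tmul {k H : Type u} [CommRing k] [Ring H] [Algebra k H]
    (t : H ⊗[k] (H ⊗[k] H)) :
    ∃ (n : ℕ) (x y z : Fin n → H), t = ∑ i, x i ⊗ₜ[k] (y i ⊗ₜ[k] z i) := by
  induction t using ind3 with
  | zero => exact ⟨0, Fin.elim0, Fin.elim0, Fin.elim0, rfl⟩
  | add s t hs ht =>
    obtain ⟨m, x, y, z, rfl⟩ := hs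
    obtain ⟨n, x', y', z', rfl⟩ := ht
    exact ⟨m + n, Fin.append x x', Fin.append y y', Fin.append z z', by simp [Fin.sum_univ_add]⟩
  | tmul a b c => exact ⟨1, fun _ => a, fun _ => b, fun _ => c, by simp⟩

end Adjunction

end HRep

/-! ### The theorem -/

theorem mainTheorem1 {k H : Type u} [CommRing k] [Ring H] [Algebra k H] [QuasiHopfAlgebra k H]
    (A : Mon (HRep k H)) :
    (∃ ζ : (curriedTensor (Bimod A A)).flip ⊣₂ HRep.homA A, ∀ V W X : Bimod A A,
      (∀ (f : V ⊗ W ⟶ X) (n : ℕ) (x y z : Fin n → H),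
        (QuasiHopfAlgebra.φ : (H ⊗[k] (H ⊗[k] H))ˣ)⁻¹.val = ∑ i, x i ⊗ₜ[k] (y i ⊗ₜ[k] z i) →
        ∀ (v : V.X) (w : W.X),
          HRep.mapA ((ζ.homEquiv f).hom.toLin v) w =
            ∑ i, f.hom.toLin (HRep.tmulA (V.X.ρ (x i) v)
              (W.X.ρ (y i * QuasiHopfAlgebra.β k * QuasiHopfAlgebra.S (k := k) (z i)) w))) ∧
      (∀ (g : V ⟶ HRep.homABimod W X) (n : ℕ) (x y z : Fin n → H),
        (QuasiHopfAlgebra.φ : (H ⊗[k] (H ⊗[k] H))ˣ).val = ∑ i, x i ⊗ₜ[k] (y i ⊗ₜ[k] z i) →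
        ∀ (v : V.X) (w : W.X),
          (ζ.homEquiv.symm g).hom.toLin (HRep.tmulA v w) =
            ∑ i, X.X.ρ (x i) (HRep.mapA (g.hom.toLin v)
              (W.X.ρ (QuasiHopfAlgebra.S (k := k) (y i) * QuasiHopfAlgebra.α k * z i) w)))) ∧
    (∀ (V W : Bimod A A) (Z : HRep k H) (q : Z ⟶ HRep.ihom V.X W.X),
      (∃ p : Z ⟶ (HRep.homABimod V W).X, p ≫ (HRep.inclBimod V W).hom = q) ↔
        ∀ (n : ℕ) (x y z : Fin n → H),
          (QuasiHopfAlgebra.φ : (H ⊗[k] (H ⊗[k] H))ˣ)⁻¹.val = ∑ i, x i ⊗ₜ[k] (y i ⊗ₜ[k] z i) →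
          ∀ (L : Z) (v : V.X) (a : A.X),
            (HRep.ev V.X W.X).toLin (q.toLin L ⊗ₜ[k] V.actRight.toLin (v ⊗ₜ[k] a)) =
              ∑ i, W.actRight.toLin ((HRep.ev V.X W.X).toLin
                ((HRep.ihom V.X W.X).ρ (x i) (q.toLin L) ⊗ₜ[k] V.X.ρ (y i) v) ⊗ₜ[k]
                  A.X.ρ (z i) a)) := by
  refine ⟨⟨HRep.tensorHomAAdj₂ A, fun V W X => ⟨?_, ?_⟩⟩, fun V W Z q => ?_⟩
  · intro f n x y z h v w
    rw [HRep.tensorHomAAdj₂_homEquiv]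
    -- By definition `curryA f` followed by the inclusion is the currying of f precomposed with the
    -- projection, and `tmulA` is the projection of a pure tensor.
    exact HRep.curryLin_eq_sum (HRep.proj V W ≫ f.hom).toLin h v w
  · intro g n x y z h v w
    rw [HRep.tensorHomAAdj₂_homEquiv]
    -- On classes v ⊗_A w the uncurried map is `evalA g` at v ⊗ w, that is, `ev` at g(v) ⊗ w.
    refine (congrArg (fun p : V.X ⊗ W.X ⟶ X.X => p.toLin (v ⊗ₜ[k] w))
      (HRep.proj_uncurryA g)).trans ?_
    exact HRep.evLin_eq_sum W.X X.X h (HRep.mapA (g.hom.toLin v)) w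
  · rw [HRep.exists_lift_iff]
    constructor
    · exact fun e n x y z h => (HRep.equalizes_iff_sum V W q h).1 e
    · intro e
      obtain ⟨n, x, y, z, h⟩ := HRep.exists_eq_sum_tmul_tmul
        (QuasiHopfAlgebra.φ : (H ⊗[k] (H ⊗[k] H))ˣ)⁻¹.val
      exact (HRep.equalizes_iff_sum V W q h).2 (e n x y z h)
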